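/- Let $n\ge 1$, $s\in(0,1)$, $p:=\max\{2,\tfrac{n}{2s}\}$, and let $\Omega\subseteq\mathbb R^n$ be open. Write $a\cdot b=\sum_i a_ib_i$ for the (bilinear) dot product on $\mathbb C^n$, and $\langle f,g\rangle=\int f\cdot g$ for the corresponding bilinear pairings on $\mathbb R^n$ and $\mathbb R^{2n}$. For $A:\mathbb R^n\times\mathbb R^n\to\mathbb C^n$ measurable put $$A_s(x,y)=\tfrac12\big(A(x,y)+A(y,x)\big),\qquad A_a=A-A_s,\qquad A_\parallel(x,y)=\begin{cases}\frac{A(x,y)\cdot(x-y)}{|x-y|^2}(x-y)&x\ne y\\ A(x,y)&x=y\end{cases},$$ $A_{s\parallel}=(A_s)_\parallel$, $A_{a\parallel}=(A_a)_\parallel$, and $\mathcal J_1A(x)=\big(\int|A(y,x)|^2dy\big)^{1/2}$, $\mathcal J_2A(x)=\big(\int|A(x,y)|^2dy\big)^{1/2}$. Let $\mathcal P_0$ be the set of pairs $(A,q)$ with $A:\mathbb R^{2n}\to\mathbb C^n$ measurable and $q:\mathbb R^n\to\mathbb R$ such that (p1) $\mathcal J_1A,\mathcal J_2A\in L^{2p}(\mathbb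 R^n)$; (p2) $A_{s\parallel}\in H^{sp-s}(\mathbb R^{2n},\mathbb C^n)$; (p3) $A_{a\parallel}(x,y)\cdot(y-x)$ is real and $\ge0$ for a.e. $(x,y)$; (p4) $q\in L^p(\Omega)$, with $q=0$ a.e. outside $\Omega$. Let $\mathcal C_{n,s}=\frac{4^s\Gamma(n/2+s)}{\pi^{n/2}|\Gamma(-s)|}$ be the constant for which $\mathcal C_{n,s}\,\mathrm{PV}\!\int\frac{u(x)-u(y)}{|x-y|^{n+2s}}dy$ has Fourier symbol $|\xi|^{2s}$, and let $\alpha(x,y)=\sqrt{\mathcal C_{n,s}/2}\,\frac{y-x}{|y-x|^{n/2+s+1}}$. For $u\in H^s(\mathbb R^n)$ (complex-valued) set $\nabla^su(x,y)=(u(x)-u(y))\alpha(x,y)$ and $\nabla^s_Au(x,y)=\nabla^su(x,y)+A(x,y)u(x)$. Let $(\nabla\cdot)^s:L^2(\mathbb R^{2n})\to H^{-s}(\mathbb R^n)$ be given by $\langle(\nabla\cdot)^sw,u\rangle=\langle w,\nabla^su\rangle$, and for $(A,q)\in\mathcal P_0$ let $(-\Delta)^s_A:H^s(\mathbb R^n)\to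 H^{-s}(\mathbb R^n)$ be given by $\langle(-\Delta)^s_Au,v\rangle=\langle\nabla^s_Au,\nabla^s_Av\rangle$ for all $v\in H^s(\mathbb R^n)$. Finally, define the distribution on $\mathbb R^n$ $$Q:=q+\int_{\mathbb R^n}A\cdot A\,dy+(\nabla\cdot)^sA_{s\parallel},$$ where $A\cdot A=\sum_iA_i(x,y)^2$, which is $|A|^2$ if $A$ is real-valued; define $Q'$ in the same way from $(A',q')$. **Lemma.** Let $(A,q),(A',q')\in\mathcal P_0$. Then $(-\Delta)^s_Au+qu=(-\Delta)^s_{A'}u+q'u$ in $H^{-s}(\mathbb R^n)$ for all $u\in H^s(\mathbb R^n)$ if and only if $A_{a\parallel}=A'_{a\parallel}$ a.e. in $\mathbb R^{2n}$ and $Q=Q'$ as distributions on $\mathbb R^n$. -/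

import Mathlib

open MeasureTheory
open scoped ENNReal ContDiff SchwartzMap

noncomputable section

namespace FracMag

/-- `ℝⁿ` with the Euclidean norm. -/
abbrev RSpace (n : ℕ) : Type := EuclideanSpace ℝ (Fin n)

/-- `ℂⁿ` with the Hermitian norm. -/
abbrev CSpace (n : ℕ) : Type := EuclideanSpace ℂ (Fin n)

variable {n : ℕ}

/-- The symmetric bilinear (not sesquilinear) dot product `a · b = ∑ aᵢ bᵢ` on `ℂⁿ`. -/
def dot (a b : CSpace n) : ℂ := ∑ i, a i * b i

/-- The inclusion `ℝⁿ ⊆ ℂⁿ`. -/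
def toC (a : RSpace n) : CSpace n := WithLp.toLp 2 fun i => (a i : ℂ)

/-- On real vectors, `a · a` is the squared Euclidean norm. -/
theorem dot_self_of_real (a : CSpace n) (ha : ∀ i, (a i).im = 0) :
    dot a a = ((‖a‖ ^ 2 : ℝ) : ℂ) := by
  rw [EuclideanSpace.norm_sq_eq, dot, Complex.ofReal_sum]
  refine Finset.sum_congr rfl fun i _ => ?_
  have h : a i = ((a i).re : ℂ) := Complex.ext rfl (by simpa using ha i)
  rw [h, ← Complex.ofReal_mul, Complex.norm_real, Real.norm_eq_abs, sq_abs, sq]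

/-! ### Parts of bivariate vector functions -/

/-- The symmetric part `A_s(x,y) = (A(x,y) + A(y,x)) / 2`. -/
def symPart (A : RSpace n × RSpace n → CSpace n) : RSpace n × RSpace n → CSpace n :=
  fun z => (1 / 2 : ℂ) • (A z + A z.swap)

/-- The antisymmetric part `A_a = A - A_s`. -/
def antiPart (A : RSpace n × RSpace n → CSpace n) : RSpace n × RSpace n → CSpace n :=
  fun z => A z - symPart A z

open Classical in
/-- The parallel part: the projection of `A(x,y)` on `x - y` if `x ≠ y`, and `A(x,y)` if `x = y`. -/
def parPart (A : RSpace n × RSpace n → CSpace n) : RSpace n × RSpace n → CSpace n :=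
  fun z => if z.1 = z.2 then A z else
    (dot (A z) (toC (z.1 - z.2)) / ((‖z.1 - z.2‖ ^ 2 : ℝ) : ℂ)) • toC (z.1 - z.2)

/-- `𝒥₁A(x) = (∫ |A(y,x)|² dy)^{1/2}`, with values in `[0,∞]`. -/
def J1 (A : RSpace n × RSpace n → CSpace n) (x : RSpace n) : ℝ≥0∞ :=
  (∫⁻ y, ‖A (y, x)‖ₑ ^ 2) ^ (1 / 2 : ℝ)

/-- `𝒥₂A(x) = (∫ |A(x,y)|² dy)^{1/2}`, with values in `[0,∞]`. -/
def J2 (A : RSpace n × RSpace n → CSpace n) (x : RSpace n) : ℝ≥0∞ :=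
  (∫⁻ y, ‖A (x, y)‖ₑ ^ 2) ^ (1 / 2 : ℝ)

/-! ### Sobolev spaces of nonnegative order -/

/-- `f ∈ H^t`, for `t ≥ 0`: `f` is an `L²` function with `⟨ξ⟩^t f̂ ∈ L²`. -/
def MemH {V F : Type*} [NormedAddCommGroup V] [InnerProductSpace ℝ V] [FiniteDimensional ℝ V]
    [MeasurableSpace V] [BorelSpace V] [NormedAddCommGroup F] [InnerProductSpace ℂ F]
    [CompleteSpace F] (t : ℝ) (f : V → F) : Prop :=
  ∃ hf : MemLp f 2 (volume : Measure V),
    TemperedDistribution.MemSobolev t 2 ((hf.toLp f : Lp F 2 (volume : Measure V)) : 𝓢'(V, F))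

/-! ### Fractional gradient and divergence -/

/-- The constant `𝒞_{n,s} = 4^s Γ(n/2+s) / (π^{n/2} |Γ(-s)|)` in the singular integral
representation of the fractional Laplacian with Fourier symbol `|ξ|^{2s}`. -/
def fracConst (n : ℕ) (s : ℝ) : ℝ :=
  (4 : ℝ) ^ s * Real.Gamma ((n : ℝ) / 2 + s) /
    (Real.pi ^ ((n : ℝ) / 2) * |Real.Gamma (-s)|)

/-- `α(x,y) = 𝒞_{n,s}^{1/2} / √2 · (y - x) / |y - x|^{n/2+s+1}`. -/
def alpha (s : ℝ) (z : RSpace n × RSpace n) : CSpace n :=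
  toC ((Real.sqrt (fracConst n s) / Real.sqrt 2 /
    ‖z.2 - z.1‖ ^ ((n : ℝ) / 2 + s + 1)) • (z.2 - z.1))

/-- The fractional gradient `∇ˢu(x,y) = (u(x) - u(y)) α(x,y)`. -/
def fracGrad (s : ℝ) (u : RSpace n → ℂ) : RSpace n × RSpace n → CSpace n :=
  fun z => (u z.1 - u z.2) • alpha s z

/-- The fractional divergence of `w ∈ L²(ℝ²ⁿ)`, as the functional
`u ↦ ⟨w, ∇ˢu⟩` dual to the fractional gradient. -/
def fracDiv (s : ℝ) (w : RSpace n × RSpace n → CSpace n) (u : RSpace n → ℂ) : ℂ :=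
  ∫ z, dot (w z) (fracGrad s u z)

/-! ### Potentials -/

/-- The exponent `p = max {2, n/(2s)}`. -/
def expo (n : ℕ) (s : ℝ) : ℝ := max 2 ((n : ℝ) / (2 * s))

/-- The class `𝒫₀` of pairs of potentials. A scalar potential in `L^p(Ω)` is a function on `ℝⁿ`
vanishing outside `Ω`. -/
structure MemP0 (s : ℝ) (Ω : Set (RSpace n)) (A : RSpace n × RSpace n → CSpace n)
    (q : RSpace n → ℝ) : Prop where
  meas : AEStronglyMeasurable A
  J1_mem : ∫⁻ x, J1 A x ^ (2 * expo n s) < ⊤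
  J2_mem : ∫⁻ x, J2 A x ^ (2 * expo n s) < ⊤
  sym_mem : MemH (s * expo n s - s)
    fun z : WithLp 2 (RSpace n × RSpace n) => parPart (symPart A) (WithLp.ofLp z)
  anti_nonneg : ∀ᵐ z : RSpace n × RSpace n,
    0 ≤ (dot (parPart (antiPart A) z) (toC (z.2 - z.1))).re ∧
      (dot (parPart (antiPart A) z) (toC (z.2 - z.1))).im = 0
  q_mem : MemLp q (ENNReal.ofReal (expo n s)) (volume.restrict Ω)
  q_zero : ∀ᵐ x ∂(volume.restrict Ωᶜ), q x = 0

/-! ### The magnetic operators -/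

/-- The magnetic fractional gradient `∇ˢ_A u(x,y) = ∇ˢu(x,y) + A(x,y) u(x)`. -/
def magGrad (s : ℝ) (A : RSpace n × RSpace n → CSpace n) (u : RSpace n → ℂ) :
    RSpace n × RSpace n → CSpace n :=
  fun z => fracGrad s u z + u z.1 • A z

/-- The magnetic fractional Laplacian: `(-Δ)ˢ_A u` is the functional `v ↦ ⟨∇ˢ_A u, ∇ˢ_A v⟩`
on `Hˢ`. -/
def magLaplacian (s : ℝ) (A : RSpace n × RSpace n → CSpace n) (u v : RSpace n → ℂ) : ℂ :=
  ∫ z, dot (magGrad s A u z) (magGrad s A v z)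

/-- `(-Δ)ˢ_A u + q u`, as a functional of `v ∈ Hˢ`. -/
def magSchrodinger (s : ℝ) (A : RSpace n × RSpace n → CSpace n) (q : RSpace n → ℝ)
    (u v : RSpace n → ℂ) : ℂ :=
  magLaplacian s A u v + ∫ x, (q x : ℂ) * u x * v x

/-- The gauge `(A,q) ∼ (A',q')`: `(-Δ)ˢ_A u + q u = (-Δ)ˢ_{A'} u + q' u` in `H⁻ˢ`
for all `u ∈ Hˢ`. -/
def GaugeEquiv (s : ℝ) (A : RSpace n × RSpace n → CSpace n) (q : RSpace n → ℝ)
    (A' : RSpace n × RSpace n → CSpace n) (q' : RSpace n → ℝ) : Prop :=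
  ∀ u : RSpace n → ℂ, MemH s u → ∀ v : RSpace n → ℂ, MemH s v →
    magSchrodinger s A q u v = magSchrodinger s A' q' u v

/-- The distribution `Q = q + ∫ A·A dy + (∇·)ˢ A_{s∥}` applied to a test function `φ`.
The zeroth order term that the bilinear pairing produces is `A·A = ∑ Aᵢ²`, that is `|A|²`
for real `A`. -/
def Q (s : ℝ) (A : RSpace n × RSpace n → CSpace n) (q : RSpace n → ℝ) (φ : RSpace n → ℂ) : ℂ :=
  (∫ x, ((q x : ℂ) + ∫ y, dot (A (x, y)) (A (x, y))) * φ x) +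
    fracDiv s (parPart (symPart A)) φ

end FracMag

end

/-!
Expanding the magnetic form and using that `α` is antisymmetric gives
`⟨(-Δ)ˢ_A u + q u, v⟩ = ⟨∇ˢu, ∇ˢv⟩ + ∬ δu δv (A_a · α) + Q(u v)`, where `δu(x, y) = u(x) - u(y)`.
All three terms are continuous for a norm made of an `L^{2p'}` norm, with `1/p + 1/p' = 1`, and the
Gagliardo seminorm. Because `n ≤ 2 s p`, this norm is controlled by that of `Hˢ` through the
critical Sobolev inequality.

If `u` and `v` have disjoint supports then `u v = 0`, and what is left of a gauge equivalence
determines `A_a · α`, hence `A_{a∥}`, off the diagonal. Taking `v = 1` on the support of `u` then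
gives `Q`. Conversely, `A_{a∥}` determines the second term, and `Q` on test functions determines
the third one, because test functions are dense in `Hˢ`.
-/

open Filter Topology
open scoped FourierTransform NNReal

noncomputable section

namespace FracMag

section Gagliardo

variable {E F : Type*} [NormedAddCommGroup E] [NormedSpace ℝ E] [MeasurableSpace E]
  [NormedAddCommGroup F]

/-- The Gagliardo seminorm `[u]_s`, where `[u]_s² = ∬ |u(x) - u(y)|² / |x - y|^(d + 2s)` and
`d = dim E`. It is written as the `L²` norm of a difference quotient to inherit the triangle
inequality. -/
def gagliardo [NormedSpace ℝ F] (s : ℝ) (u : E → F) (μ : Measure E) : ℝ≥0∞ :=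
  eLpNorm (fun z : E × E =>
    ‖z.1 - z.2‖ ^ (-((Module.finrank ℝ E : ℝ) / 2 + s)) • (u z.1 - u z.2)) 2 (μ.prod μ)

theorem eLpNorm_two_sq {α : Type*} [MeasurableSpace α] {μ : Measure α} (f : α → F) :
    eLpNorm f 2 μ ^ 2 = ∫⁻ x, ‖f x‖ₑ ^ 2 ∂μ := by
  rw [eLpNorm_eq_lintegral_rpow_enorm_toReal (by norm_num) (by norm_num)]
  simp only [ENNReal.toReal_ofNat, ENNReal.rpow_ofNat]
  rw [← ENNReal.rpow_natCast, ← ENNReal.rpow_mul]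
  norm_num

/-- The integrand of `[u]_s²`, integrated in the second variable only. -/
def gagliardoDensity (s : ℝ) (u : E → F) (μ : Measure E) (x : E) : ℝ≥0∞ :=
  ∫⁻ y, ‖u x - u y‖ₑ ^ 2 * ENNReal.ofReal (‖x - y‖ ^ (-((Module.finrank ℝ E : ℝ) + 2 * s))) ∂μ

variable {μ : Measure E} {s : ℝ} {u : E → F}

variable [BorelSpace E] [FiniteDimensional ℝ E]

theorem aestronglyMeasurable_quotient [NormedSpace ℝ F] [SFinite μ]
    (hu : AEStronglyMeasurable u μ) (b : ℝ) :
    AEStronglyMeasurable (fun z : E × E => ‖z.1 - z.2‖ ^ b • (u z.1 - u z.2)) (μ.prod μ) := by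
  refine AEStronglyMeasurable.smul (Measurable.aestronglyMeasurable ?_)
    (hu.comp_fst.sub hu.comp_snd)
  fun_prop

theorem gagliardo_sq [NormedSpace ℝ F] [SFinite μ] (hu : AEStronglyMeasurable u μ) :
    gagliardo s u μ ^ 2 = ∫⁻ x, gagliardoDensity s u μ x ∂μ := by
  rw [gagliardo, eLpNorm_two_sq,
    lintegral_prod _ ((aestronglyMeasurable_quotient hu _).enorm.pow_const 2)]
  refine lintegral_congr fun x => lintegral_congr fun y => ?_
  rw [enorm_smul, mul_pow, mul_comm, ← ofReal_norm (_ ^ _),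
    Real.norm_of_nonneg (by positivity), ← ENNReal.ofReal_pow (by positivity),
    ← Real.rpow_mul_natCast (norm_nonneg _)]
  congr 3
  push_cast
  ring

theorem gagliardo_add_le [NormedSpace ℝ F] [SFinite μ] {v : E → F}
    (hu : AEStronglyMeasurable u μ) (hv : AEStronglyMeasurable v μ) :
    gagliardo s (u + v) μ ≤ gagliardo s u μ + gagliardo s v μ := by
  refine (eLpNorm_congr_ae (.of_forall fun z => ?_)).trans_le (eLpNorm_add_le
    (aestronglyMeasurable_quotient hu _) (aestronglyMeasurable_quotient hv _) one_le_two)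
  simp only [Pi.add_apply, ← smul_add]
  congr 1
  abel

end Gagliardo

/-! ### The critical Sobolev inequality -/

section Sobolev

variable {E F : Type*} [NormedAddCommGroup E] [NormedSpace ℝ E] [MeasurableSpace E] [BorelSpace E]
  [NormedAddCommGroup F] {μ : Measure E} {u : E → F} {s p p' : ℝ}

theorem setLIntegral_ball_enorm_sub_sq_le (hs : 0 ≤ s) (x : E) {r : ℝ} (hr : 0 < r) :
    ∫⁻ y in Metric.ball x r, ‖u x - u y‖ₑ ^ 2 ∂μ ≤
      ENNReal.ofReal (r ^ ((Module.finrank ℝ E : ℝ) + 2 * s)) * gagliardoDensity s u μ x := by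
  set b : ℝ := (Module.finrank ℝ E : ℝ) + 2 * s
  rw [gagliardoDensity, ← lintegral_const_mul' _ _ ENNReal.ofReal_ne_top]
  refine (setLIntegral_mono' measurableSet_ball fun y hy => ?_).trans
    (setLIntegral_le_lintegral _ _)
  rcases eq_or_ne x y with rfl | hxy
  · simp
  have hnorm : 0 < ‖x - y‖ := norm_sub_pos_iff.2 hxy
  have hle : ‖x - y‖ ≤ r := by simpa [dist_eq_norm'] using (Metric.mem_ball.1 hy).le
  have hone : 1 ≤ r ^ b * ‖x - y‖ ^ (-b) := by
    rw [Real.rpow_neg hnorm.le, ← div_eq_mul_inv, one_le_div (by positivity)]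
    gcongr
  rw [mul_left_comm, ← ENNReal.ofReal_mul (by positivity)]
  exact le_mul_of_one_le_right zero_le (ENNReal.one_le_ofReal.2 hone)

theorem setLIntegral_enorm_sq_le {α : Type*} [MeasurableSpace α] {μ : Measure α} {u : α → F}
    (hp : p.HolderConjugate p') (hu : AEStronglyMeasurable u μ) (B : Set α) :
    ∫⁻ y in B, ‖u y‖ₑ ^ 2 ∂μ ≤ μ B ^ (1 / p) * eLpNorm u (ENNReal.ofReal (2 * p')) μ ^ 2 := by
  have hp' := hp.symm.lt
  have hexp : (1 / (2 : ℝ≥0∞).toReal - 1 / (ENNReal.ofReal (2 * p')).toReal) = 1 / p / 2 := by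
    rw [ENNReal.toReal_ofReal (by linarith), ENNReal.toReal_ofNat, one_div p, ← hp.symm.one_sub_inv]
    field_simp
  have htwo : (2 : ℝ≥0∞) ≤ ENNReal.ofReal (2 * p') := by
    rw [← ENNReal.ofReal_ofNat]
    exact ENNReal.ofReal_le_ofReal (by linarith)
  calc ∫⁻ y in B, ‖u y‖ₑ ^ 2 ∂μ = eLpNorm u 2 (μ.restrict B) ^ 2 := (eLpNorm_two_sq u).symm
    _ ≤ (eLpNorm u (ENNReal.ofReal (2 * p')) (μ.restrict B) * μ B ^ (1 / p / 2)) ^ 2 := by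
        grw [eLpNorm_le_eLpNorm_mul_rpow_measure_univ htwo hu.restrict, Measure.restrict_apply_univ,
          hexp]
    _ = μ B ^ (1 / p) * eLpNorm u (ENNReal.ofReal (2 * p')) (μ.restrict B) ^ 2 := by
        rw [mul_pow, mul_comm, ← ENNReal.rpow_mul_natCast, Nat.cast_ofNat,
          div_mul_cancel₀ _ two_ne_zero]
    _ ≤ _ := by
        gcongr
        exact Measure.restrict_le_self

theorem measure_ball_mul_enorm_sq_le (hp : p.HolderConjugate p') (hs : 0 ≤ s)
    (hu : AEStronglyMeasurable u μ) (x : E) {r : ℝ} (hr : 0 < r) :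
    μ (Metric.ball x r) * ‖u x‖ₑ ^ 2 ≤
      2 * ENNReal.ofReal (r ^ ((Module.finrank ℝ E : ℝ) + 2 * s)) * gagliardoDensity s u μ x +
        2 * μ (Metric.ball x r) ^ (1 / p) * eLpNorm u (ENNReal.ofReal (2 * p')) μ ^ 2 := by
  have hsplit : ∀ y, ‖u x‖ₑ ^ 2 ≤ 2 * ‖u x - u y‖ₑ ^ 2 + 2 * ‖u y‖ₑ ^ 2 := fun y => by
    calc ‖u x‖ₑ ^ 2 ≤ (‖u x - u y‖ₑ + ‖u y‖ₑ) ^ 2 := by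
          gcongr
          simpa using enorm_add_le (u x - u y) (u y)
      _ ≤ 2 * ‖u x - u y‖ₑ ^ 2 + 2 * ‖u y‖ₑ ^ 2 := by
          simpa [mul_add, show (2 : ℝ) - 1 = 1 by norm_num] using
            ENNReal.rpow_add_le_mul_rpow_add_rpow ‖u x - u y‖ₑ ‖u y‖ₑ (p := 2) one_le_two
  calc μ (Metric.ball x r) * ‖u x‖ₑ ^ 2 = ∫⁻ _ in Metric.ball x r, ‖u x‖ₑ ^ 2 ∂μ := by
        rw [setLIntegral_const, mul_comm]
    _ ≤ ∫⁻ y in Metric.ball x r, (2 * ‖u x - u y‖ₑ ^ 2 + 2 * ‖u y‖ₑ ^ 2) ∂μ :=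
        lintegral_mono hsplit
    _ = 2 * ∫⁻ y in Metric.ball x r, ‖u x - u y‖ₑ ^ 2 ∂μ +
          2 * ∫⁻ y in Metric.ball x r, ‖u y‖ₑ ^ 2 ∂μ := by
        rw [lintegral_add_right' _ ((hu.restrict.enorm.pow_const 2).const_mul 2),
          lintegral_const_mul' _ _ (by norm_num), lintegral_const_mul' _ _ (by norm_num)]
    _ ≤ _ := by
        rw [mul_assoc, mul_assoc]
        gcongr
        · exact setLIntegral_ball_enorm_sub_sq_le hs x hr
        · exact setLIntegral_enorm_sq_le hp hu _

/-- Optimization over the volume `V`: the choice made here lets the last term absorb half of the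
left-hand side. -/
theorem rpow_le_of_forall_volume {a m c D : ℝ} (hp : p.HolderConjugate p') (ha : 0 < a)
    (hm : 0 < m) (hc : 0 < c)
    (h : ∀ V : ℝ, 0 < V → V * a ≤ 2 * (V / c) ^ (1 + 1 / p) * D + 2 * V ^ (1 / p) * m) :
    a ^ p' ≤ 4 ^ p' * c ^ (-(1 + 1 / p)) * (m ^ (p' - 1) * D) := by
  set X : ℝ := 4 * m / a with hX
  set k : ℝ := c ^ (-(1 + 1 / p))
  set W : ℝ := X ^ (p' - 1)
  have hX0 : 0 < X := by positivity
  have hW : 0 < W := by positivity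
  have hV : X ^ p' = X * W := by
    rw [← Real.rpow_one_add' hX0.le (by simpa using hp.symm.ne_zero)]
    simp
  have hVp : (X ^ p') ^ (1 / p) = W := by
    rw [← Real.rpow_mul hX0.le, mul_one_div, hp.symm.div_conj_eq_sub_one]
  have hVc : (X ^ p' / c) ^ (1 + 1 / p) = X * W * W * k := by
    rw [Real.div_rpow (by positivity) hc.le, Real.rpow_add (by positivity), hVp, Real.rpow_one, hV,
      div_eq_mul_inv, ← Real.rpow_neg hc.le]
  have hXa : X * a = 4 * m := by rw [hX]; field_simp
  have hmain : m ≤ X * W * k * D := by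
    have hvol := h (X ^ p') (by positivity)
    rw [hVc, hVp, hV] at hvol
    refine le_of_mul_le_mul_left ?_ hW
    linear_combination hvol / 2 - W / 2 * hXa
  calc a ^ p' = a ^ (p' - 1) * a := by
        rw [← Real.rpow_add_one ha.ne', sub_add_cancel]
    _ ≤ a ^ (p' - 1) * (4 * W * k * D) := by
        gcongr
        refine le_of_mul_le_mul_right ?_ hm
        calc a * m ≤ a * (X * W * k * D) := by gcongr
          _ = 4 * W * k * D * m := by linear_combination W * k * D * hXa
    _ = 4 ^ p' * k * (m ^ (p' - 1) * D) := by
        have hfour : (4 : ℝ) ^ p' = 4 ^ (p' - 1) * 4 := by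
          rw [← Real.rpow_add_one four_ne_zero, sub_add_cancel]
        have hWa : a ^ (p' - 1) * W = 4 ^ (p' - 1) * m ^ (p' - 1) := by
          rw [← Real.mul_rpow ha.le hX0.le, mul_comm a, hXa, Real.mul_rpow four_pos.le hm.le]
        rw [hfour]
        linear_combination 4 * k * D * hWa

variable [FiniteDimensional ℝ E]

theorem exists_ball_volume [Nontrivial E] (μ : Measure E) [μ.IsAddHaarMeasure] :
    ∃ c : ℝ, 0 < c ∧ ∀ V : ℝ, 0 < V → ∃ r : ℝ, 0 < r ∧
      r ^ (Module.finrank ℝ E : ℝ) = V / c ∧ ∀ x : E, μ (Metric.ball x r) = ENNReal.ofReal V := by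
  have hd : (Module.finrank ℝ E : ℝ) ≠ 0 := by exact_mod_cast Module.finrank_pos.ne'
  have hfin : μ (Metric.ball (0 : E) 1) ≠ ⊤ := measure_ball_lt_top.ne
  have hc : 0 < (μ (Metric.ball (0 : E) 1)).toReal :=
    ENNReal.toReal_pos (Metric.measure_ball_pos μ 0 one_pos).ne' hfin
  refine ⟨_, hc, fun V hV => ⟨_, by positivity, Real.rpow_inv_rpow (by positivity) hd, fun x => ?_⟩⟩
  rw [Measure.addHaar_ball_of_pos _ _ (by positivity), ← Real.rpow_natCast,
    Real.rpow_inv_rpow (by positivity) hd]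
  nth_rewrite 2 [← ENNReal.ofReal_toReal hfin]
  rw [← ENNReal.ofReal_mul (by positivity), div_mul_cancel₀ _ hc.ne']

theorem enorm_rpow_le_gagliardoDensity [Nontrivial E] (μ : Measure E) [μ.IsAddHaarMeasure]
    (hp : p.HolderConjugate p') :
    ∃ C : ℝ≥0, ∀ u : E → F, AEStronglyMeasurable u μ →
      eLpNorm u (ENNReal.ofReal (2 * p')) μ ≠ 0 → eLpNorm u (ENNReal.ofReal (2 * p')) μ ≠ ⊤ → ∀ x,
      ‖u x‖ₑ ^ (2 * p') ≤ C * ((eLpNorm u (ENNReal.ofReal (2 * p')) μ ^ 2) ^ (p' - 1) *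
        gagliardoDensity ((Module.finrank ℝ E : ℝ) / (2 * p)) u μ x) := by
  obtain ⟨c, hc, hvol⟩ := exists_ball_volume μ
  set K : ℝ := 4 ^ p' * c ^ (-(1 + 1 / p))
  have hK : 0 < K := by positivity
  refine ⟨K.toNNReal, fun u hu hu0 hutop x => ?_⟩
  set M := eLpNorm u (ENNReal.ofReal (2 * p')) μ
  set s : ℝ := (Module.finrank ℝ E : ℝ) / (2 * p)
  set D := gagliardoDensity s u μ x with hD
  have hp' := hp.symm.pos
  rcases eq_or_ne (u x) 0 with hux | hux
  · simp [hux, ENNReal.zero_rpow_of_pos (mul_pos two_pos hp')]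
  rcases eq_or_ne D ⊤ with hDtop | hDtop
  · rw [hDtop, ENNReal.mul_top (by positivity), ENNReal.mul_top (by simpa using hK)]
    exact le_top
  have hs : 0 ≤ s := div_nonneg (Nat.cast_nonneg _) (mul_nonneg two_pos.le hp.nonneg)
  have hreal := rpow_le_of_forall_volume (a := ‖u x‖ ^ 2) (m := (M ^ 2).toReal)
    (D := D.toReal) hp (by positivity)
    (ENNReal.toReal_pos (by positivity) (by finiteness)) hc fun V hV => ?_
  · rw [ENNReal.rpow_mul, ENNReal.rpow_ofNat]
    refine (ENNReal.toReal_le_toReal (by finiteness) (by finiteness)).1 ?_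
    simpa only [← ENNReal.toReal_rpow, ENNReal.toReal_mul, ENNReal.toReal_pow, toReal_enorm,
      ENNReal.coe_toReal, Real.coe_toNNReal K hK.le] using hreal
  · obtain ⟨r, hr, hrV, hball⟩ := hvol V hV
    have hrs : r ^ ((Module.finrank ℝ E : ℝ) + 2 * s) = (V / c) ^ (1 + 1 / p) := by
      rw [← hrV, ← Real.rpow_mul hr.le]
      congr 1
      simp only [s]
      field_simp [hp.ne_zero]
    have hle := measure_ball_mul_enorm_sq_le hp hs hu x hr
    rw [hball, ← hD, hrs] at hle
    have : 0 ≤ 1 / p := hp.one_div_nonneg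
    have hle' := ENNReal.toReal_mono (by finiteness) hle
    rw [ENNReal.toReal_add (by finiteness) (by finiteness)] at hle'
    simpa only [ENNReal.toReal_mul, ENNReal.toReal_pow, ← ENNReal.toReal_rpow, toReal_enorm,
      ENNReal.toReal_ofNat, ENNReal.toReal_ofReal hV.le,
      ENNReal.toReal_ofReal (by positivity : 0 ≤ (V / c) ^ (1 + 1 / p))] using hle'

theorem eLpNorm_le_gagliardo [Nontrivial E] (μ : Measure E) [μ.IsAddHaarMeasure] [NormedSpace ℝ F]
    (hp : p.HolderConjugate p') :
    ∃ C : ℝ≥0, ∀ u : E → F, AEStronglyMeasurable u μ →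
      eLpNorm u (ENNReal.ofReal (2 * p')) μ ≠ ⊤ →
      eLpNorm u (ENNReal.ofReal (2 * p')) μ ≤
        C * gagliardo ((Module.finrank ℝ E : ℝ) / (2 * p)) u μ := by
  obtain ⟨C, hC⟩ := enorm_rpow_le_gagliardoDensity (F := F) μ hp
  refine ⟨NNReal.sqrt C, fun u hu hutop => ?_⟩
  set M := eLpNorm u (ENNReal.ofReal (2 * p')) μ with hM
  rcases eq_or_ne M 0 with hu0 | hu0
  · simp [hu0]
  have hp' := hp.symm.pos
  have hpow : (M ^ 2) ^ p' = ∫⁻ x, ‖u x‖ₑ ^ (2 * p') ∂μ := by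
    rw [hM, eLpNorm_eq_lintegral_rpow_enorm_toReal (by simpa using hp') ENNReal.ofReal_ne_top,
      ENNReal.toReal_ofReal (by positivity), ← ENNReal.rpow_natCast, ← ENNReal.rpow_mul,
      ← ENNReal.rpow_mul]
    field_simp
    simp
  have hint : (M ^ 2) ^ (p' - 1) * M ^ 2 ≤ (M ^ 2) ^ (p' - 1) * (C * gagliardo _ u μ ^ 2) :=
    calc (M ^ 2) ^ (p' - 1) * M ^ 2 = (M ^ 2) ^ p' := by
          nth_rewrite 2 [← ENNReal.rpow_one (M ^ 2)]
          rw [← ENNReal.rpow_add _ _ (by positivity) (by finiteness), sub_add_cancel]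
      _ ≤ ∫⁻ x, C * ((M ^ 2) ^ (p' - 1) *
            gagliardoDensity ((Module.finrank ℝ E : ℝ) / (2 * p)) u μ x) ∂μ := by
          rw [hpow]
          exact lintegral_mono fun x => hC u hu hu0 hutop x
      _ = (M ^ 2) ^ (p' - 1) * (C * gagliardo _ u μ ^ 2) := by
          rw [gagliardo_sq hu, lintegral_const_mul' _ _ (by finiteness),
            lintegral_const_mul' _ _ (by finiteness), mul_left_comm]
  have hsq : M ^ 2 ≤ (NNReal.sqrt C * gagliardo ((Module.finrank ℝ E : ℝ) / (2 * p)) u μ) ^ 2 := by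
    rw [mul_pow, ← ENNReal.coe_pow, NNReal.sq_sqrt]
    exact (ENNReal.mul_le_mul_iff_right (by positivity) (by finiteness)).1 hint
  exact (ENNReal.pow_le_pow_left_iff two_ne_zero).1 hsq

end Sobolev

/-! ### The Gagliardo seminorm and the Fourier transform -/

section Radial

variable {E : Type*} [NormedAddCommGroup E] [NormedSpace ℝ E] [MeasurableSpace E] [BorelSpace E]
  [FiniteDimensional ℝ E] (μ : Measure E) [μ.IsAddHaarMeasure]

theorem lintegral_comp_smul_addHaar (f : E → ℝ≥0∞) {R : ℝ} (hR : 0 < R) :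
    ∫⁻ x, f (R • x) ∂μ = ENNReal.ofReal ((R ^ Module.finrank ℝ E)⁻¹) * ∫⁻ x, f x ∂μ := by
  have hmap := (Homeomorph.smulOfNeZero R hR.ne' : E ≃ₜ E).measurableEmbedding.lintegral_map
    (μ := μ) f
  have hscale : Measure.map (Homeomorph.smulOfNeZero R hR.ne' : E ≃ₜ E) μ =
      ENNReal.ofReal |(R ^ Module.finrank ℝ E)⁻¹| • μ := Measure.map_addHaar_smul μ hR.ne'
  rw [hscale, lintegral_smul_measure, abs_of_pos (by positivity)] at hmap
  exact hmap.symm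

theorem lintegral_min_mul_norm_rpow {s r : ℝ} (hs : 0 < s) (hr : 0 ≤ r) :
    ∫⁻ x : E, ENNReal.ofReal
      (min 1 ((r * ‖x‖) ^ 2) * ‖x‖ ^ (-((Module.finrank ℝ E : ℝ) + 2 * s))) ∂μ =
    ENNReal.ofReal (r ^ (2 * s)) * ∫⁻ x : E, ENNReal.ofReal
      (min 1 (‖x‖ ^ 2) * ‖x‖ ^ (-((Module.finrank ℝ E : ℝ) + 2 * s))) ∂μ := by
  rcases hr.eq_or_lt with rfl | hr
  · simp [Real.zero_rpow (by positivity : 2 * s ≠ 0)]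
  have hscale := lintegral_comp_smul_addHaar μ (fun x : E => ENNReal.ofReal
      (min 1 (‖x‖ ^ 2) * ‖x‖ ^ (-((Module.finrank ℝ E : ℝ) + 2 * s)))) hr
  have hpoint : ∀ x : E, ENNReal.ofReal
      (min 1 (‖r • x‖ ^ 2) * ‖r • x‖ ^ (-((Module.finrank ℝ E : ℝ) + 2 * s))) =
      ENNReal.ofReal (r ^ (-((Module.finrank ℝ E : ℝ) + 2 * s))) * ENNReal.ofReal
      (min 1 ((r * ‖x‖) ^ 2) * ‖x‖ ^ (-((Module.finrank ℝ E : ℝ) + 2 * s))) := by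
    intro x
    rw [norm_smul, Real.norm_eq_abs, abs_of_pos hr, Real.mul_rpow hr.le (norm_nonneg _),
      ← ENNReal.ofReal_mul (by positivity)]
    congr 1
    ring
  simp_rw [hpoint] at hscale
  rw [lintegral_const_mul' _ _ ENNReal.ofReal_ne_top] at hscale
  have hcancel : ENNReal.ofReal (r ^ ((Module.finrank ℝ E : ℝ) + 2 * s)) *
      ENNReal.ofReal (r ^ (-((Module.finrank ℝ E : ℝ) + 2 * s))) = 1 := by
    rw [← ENNReal.ofReal_mul (by positivity), ← Real.rpow_add hr]
    simp
  rw [← one_mul (lintegral μ _), ← hcancel, mul_assoc, hscale, ← mul_assoc,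
    ← ENNReal.ofReal_mul (by positivity), ← Real.rpow_natCast, ← Real.rpow_neg hr.le,
    ← Real.rpow_add hr]
  congr 3
  ring

theorem lintegral_min_norm_rpow_lt_top [Nontrivial E] {s : ℝ} (hs : s ∈ Set.Ioo (0 : ℝ) 1) :
    ∫⁻ x : E, ENNReal.ofReal
      (min 1 (‖x‖ ^ 2) * ‖x‖ ^ (-((Module.finrank ℝ E : ℝ) + 2 * s))) ∂μ < ⊤ := by
  obtain ⟨hs0, hs1⟩ := hs
  have hd : 1 ≤ Module.finrank ℝ E := Module.finrank_pos
  have hpow : ∀ y : ℝ, 0 < y → ∀ b : ℝ, y ^ (Module.finrank ℝ E - 1) *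
      (y ^ b * y ^ (-((Module.finrank ℝ E : ℝ) + 2 * s))) = y ^ (b - 1 - 2 * s) := by
    intro y hy b
    rw [← Real.rpow_natCast, ← Real.rpow_add hy, ← Real.rpow_add hy, Nat.cast_sub hd]
    congr 1
    push_cast
    ring
  have hint : Integrable (fun x : E => min 1 (‖x‖ ^ 2) *
      ‖x‖ ^ (-((Module.finrank ℝ E : ℝ) + 2 * s))) μ := by
    rw [integrable_fun_norm_addHaar μ
      (f := fun y : ℝ => min 1 (y ^ 2) * y ^ (-((Module.finrank ℝ E : ℝ) + 2 * s))),
      ← Set.Ioc_union_Ioi_eq_Ioi zero_le_one]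
    refine IntegrableOn.union ?_ ?_
    · have hnear : IntegrableOn (fun y : ℝ => y ^ (2 - 1 - 2 * s)) (Set.Ioc 0 1) := by
        rw [integrableOn_Ioc_iff_integrableOn_Ioo]
        exact (intervalIntegral.integrableOn_Ioo_rpow_iff one_pos).2 (by linarith)
      refine hnear.congr_fun (fun y hy => ?_) measurableSet_Ioc
      simp only [smul_eq_mul]
      rw [min_eq_right (pow_le_one₀ hy.1.le hy.2), ← hpow y hy.1]
      norm_num
    · have hfar : IntegrableOn (fun y : ℝ => y ^ (0 - 1 - 2 * s)) (Set.Ioi 1) :=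
        integrableOn_Ioi_rpow_of_lt (by linarith) one_pos
      refine hfar.congr_fun (fun y hy => ?_) measurableSet_Ioi
      have hy1 : (1 : ℝ) < y := hy
      simp only [smul_eq_mul]
      rw [min_eq_left (one_le_pow₀ hy1.le), ← hpow y (by linarith)]
      norm_num
  exact hint.lintegral_lt_top

end Radial

section SchwartzGagliardo

variable {E F : Type*} [NormedAddCommGroup E] [InnerProductSpace ℝ E] [MeasurableSpace E]
  [BorelSpace E] [FiniteDimensional ℝ E] [NormedAddCommGroup F] [InnerProductSpace ℂ F]

theorem fourier_compSubConstCLM_apply (f : 𝓢(E, F)) (h ξ : E) :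
    𝓕 (SchwartzMap.compSubConstCLM ℂ (-h) f) ξ =
      (Real.fourierChar (inner ℝ h ξ) : ℂ) • 𝓕 f ξ := by
  have htranslate : (SchwartzMap.compSubConstCLM ℂ (-h) f : E → F) = f ∘ fun v => v + h := by
    ext x
    simp
  rw [SchwartzMap.fourier_coe, SchwartzMap.fourier_coe, htranslate]
  exact congrFun (VectorFourier.fourierIntegral_comp_add_right Real.fourierChar volume
    (innerₗ E) f h) ξ

theorem norm_one_sub_fourierChar_sq_le (t : ℝ) :
    ‖(1 : ℂ) - Real.fourierChar t‖ ^ 2 ≤ 4 * min 1 ((2 * Real.pi * |t|) ^ 2) := by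
  rw [norm_sub_rev, Real.fourierChar_apply]
  have hle_linear : ‖Complex.exp ((2 * Real.pi * t : ℝ) * Complex.I) - 1‖ ≤ 2 * Real.pi * |t| := by
    have := Real.norm_exp_I_mul_ofReal_sub_one_le (x := 2 * Real.pi * t)
    rw [mul_comm Complex.I] at this
    refine this.trans (le_of_eq ?_)
    rw [Real.norm_eq_abs, abs_mul, abs_of_pos Real.two_pi_pos]
  have hle_two : ‖Complex.exp ((2 * Real.pi * t : ℝ) * Complex.I) - 1‖ ≤ 2 := by
    refine (norm_sub_le _ _).trans ?_
    rw [Complex.norm_exp_ofReal_mul_I]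
    norm_num
  rw [mul_min_of_nonneg _ _ (by norm_num)]
  refine le_min ?_ ?_
  · nlinarith [norm_nonneg (Complex.exp ((2 * Real.pi * t : ℝ) * Complex.I) - 1)]
  · nlinarith [norm_nonneg (Complex.exp ((2 * Real.pi * t : ℝ) * Complex.I) - 1)]

theorem lintegral_one_sub_fourierChar_le [Nontrivial E] {s : ℝ} (hs : s ∈ Set.Ioo (0 : ℝ) 1) :
    ∃ C : ℝ≥0, ∀ ξ : E, ∫⁻ h : E, ‖(1 : ℂ) - Real.fourierChar (inner ℝ h ξ)‖ₑ ^ 2 *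
        ENNReal.ofReal (‖h‖ ^ (-((Module.finrank ℝ E : ℝ) + 2 * s))) ≤
      C * ENNReal.ofReal (‖ξ‖ ^ (2 * s)) := by
  set a : ℝ := -((Module.finrank ℝ E : ℝ) + 2 * s)
  set I := ∫⁻ h : E, ENNReal.ofReal (min 1 (‖h‖ ^ 2) * ‖h‖ ^ a)
  have hI : I ≠ ⊤ := (lintegral_min_norm_rpow_lt_top (volume : Measure E) hs).ne
  refine ⟨(4 * ENNReal.ofReal ((2 * Real.pi) ^ (2 * s)) * I).toNNReal, fun ξ => ?_⟩
  rw [ENNReal.coe_toNNReal (by finiteness)]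
  have hchar : ∀ h : E, ‖(1 : ℂ) - Real.fourierChar (inner ℝ h ξ)‖ₑ ^ 2 ≤
      4 * ENNReal.ofReal (min 1 ((2 * Real.pi * ‖ξ‖ * ‖h‖) ^ 2)) := fun h => by
    rw [← ofReal_norm, ← ENNReal.ofReal_pow (norm_nonneg _), ← ENNReal.ofReal_ofNat,
      ← ENNReal.ofReal_mul (by norm_num)]
    refine ENNReal.ofReal_le_ofReal ((norm_one_sub_fourierChar_sq_le _).trans ?_)
    have hinner : 2 * Real.pi * |inner ℝ h ξ| ≤ 2 * Real.pi * ‖ξ‖ * ‖h‖ := by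
      rw [mul_assoc _ ‖ξ‖, mul_comm ‖ξ‖]
      gcongr
      exact abs_real_inner_le_norm h ξ
    gcongr
  calc ∫⁻ h : E, ‖(1 : ℂ) - Real.fourierChar (inner ℝ h ξ)‖ₑ ^ 2 * ENNReal.ofReal (‖h‖ ^ a)
      ≤ ∫⁻ h : E, 4 * ENNReal.ofReal (min 1 ((2 * Real.pi * ‖ξ‖ * ‖h‖) ^ 2) * ‖h‖ ^ a) := by
        refine lintegral_mono fun h => ?_
        rw [ENNReal.ofReal_mul (by positivity), ← mul_assoc]
        gcongr
        exact hchar h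
    _ = 4 * ENNReal.ofReal ((2 * Real.pi) ^ (2 * s)) * I * ENNReal.ofReal (‖ξ‖ ^ (2 * s)) := by
        rw [lintegral_const_mul' _ _ (by finiteness),
          lintegral_min_mul_norm_rpow volume hs.1 (by positivity),
          Real.mul_rpow Real.two_pi_pos.le (norm_nonneg _), ENNReal.ofReal_mul (by positivity)]
        ring

variable [CompleteSpace F]

theorem eLpNorm_fourier_eq (f : 𝓢(E, F)) :
    eLpNorm (𝓕 f : 𝓢(E, F)) 2 volume = eLpNorm f 2 volume := by
  have h := SchwartzMap.norm_fourier_toL2_eq f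
  rwa [SchwartzMap.norm_toLp, SchwartzMap.norm_toLp, ENNReal.toReal_eq_toReal_iff'
    (SchwartzMap.eLpNorm_lt_top _ 2 volume).ne (SchwartzMap.eLpNorm_lt_top f 2 volume).ne] at h

theorem lintegral_enorm_sub_comp_add_right_sq (f : 𝓢(E, F)) (h : E) :
    ∫⁻ x, ‖f x - f (x + h)‖ₑ ^ 2 =
      ∫⁻ ξ, ‖(1 : ℂ) - Real.fourierChar (inner ℝ h ξ)‖ₑ ^ 2 * ‖𝓕 f ξ‖ₑ ^ 2 := by
  set g := f - SchwartzMap.compSubConstCLM ℂ (-h) f with hg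
  have hfourier : ∀ ξ, 𝓕 g ξ = ((1 : ℂ) - Real.fourierChar (inner ℝ h ξ)) • 𝓕 f ξ := fun ξ => by
    have hsub : 𝓕 g = 𝓕 f - 𝓕 (SchwartzMap.compSubConstCLM ℂ (-h) f) :=
      (FourierTransform.fourierCLM ℂ 𝓢(E, F)).map_sub _ _
    rw [hsub, sub_apply, fourier_compSubConstCLM_apply, sub_smul, one_smul]
  calc ∫⁻ x, ‖f x - f (x + h)‖ₑ ^ 2 = eLpNorm g 2 volume ^ 2 := by
        simp only [eLpNorm_two_sq, hg, sub_apply, SchwartzMap.compSubConstCLM_apply, sub_neg_eq_add]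
    _ = ∫⁻ ξ, ‖𝓕 g ξ‖ₑ ^ 2 := by rw [← eLpNorm_fourier_eq, eLpNorm_two_sq]
    _ = _ := by simp only [hfourier, enorm_smul, mul_pow]

theorem gagliardo_sq_eq_lintegral_fourier (s : ℝ) (f : 𝓢(E, F)) :
    gagliardo s f volume ^ 2 = ∫⁻ ξ, ‖𝓕 f ξ‖ₑ ^ 2 *
      ∫⁻ h : E, ‖(1 : ℂ) - Real.fourierChar (inner ℝ h ξ)‖ₑ ^ 2 *
        ENNReal.ofReal (‖h‖ ^ (-((Module.finrank ℝ E : ℝ) + 2 * s))) := by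
  set a : ℝ := -((Module.finrank ℝ E : ℝ) + 2 * s) with ha
  have hf := f.continuous
  have hcont := (𝓕 f).continuous
  calc gagliardo s f volume ^ 2
      = ∫⁻ x, ∫⁻ h, ‖f x - f (x + h)‖ₑ ^ 2 * ENNReal.ofReal (‖h‖ ^ a) := by
        rw [gagliardo_sq f.continuous.aestronglyMeasurable]
        refine lintegral_congr fun x => ?_
        rw [gagliardoDensity, ← lintegral_add_left_eq_self _ x]
        simp [ha]
    _ = ∫⁻ h, ∫⁻ x, ‖f x - f (x + h)‖ₑ ^ 2 * ENNReal.ofReal (‖h‖ ^ a) := by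
        rw [lintegral_lintegral_swap]
        fun_prop
    _ = ∫⁻ h : E, ∫⁻ ξ, ‖𝓕 f ξ‖ₑ ^ 2 * (‖(1 : ℂ) - Real.fourierChar (inner ℝ h ξ)‖ₑ ^ 2 *
          ENNReal.ofReal (‖h‖ ^ a)) := by
        refine lintegral_congr fun h => ?_
        rw [lintegral_mul_const' _ _ ENNReal.ofReal_ne_top, lintegral_enorm_sub_comp_add_right_sq,
          ← lintegral_mul_const' _ _ ENNReal.ofReal_ne_top]
        exact lintegral_congr fun ξ => by ring
    _ = _ := by
        rw [lintegral_lintegral_swap]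
        · exact lintegral_congr fun ξ => lintegral_const_mul' _ _ (by finiteness)
        · fun_prop

theorem gagliardo_sq_le_lintegral_fourier [Nontrivial E] {s : ℝ} (hs : s ∈ Set.Ioo (0 : ℝ) 1) :
    ∃ C : ℝ≥0, ∀ f : 𝓢(E, F), gagliardo s f volume ^ 2 ≤
      C * ∫⁻ ξ, ENNReal.ofReal (‖ξ‖ ^ (2 * s)) * ‖𝓕 f ξ‖ₑ ^ 2 := by
  obtain ⟨C, hC⟩ := lintegral_one_sub_fourierChar_le (E := E) hs
  refine ⟨C, fun f => ?_⟩
  rw [gagliardo_sq_eq_lintegral_fourier, ← lintegral_const_mul' _ _ ENNReal.coe_ne_top]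
  refine lintegral_mono fun ξ => ?_
  rw [← mul_assoc, mul_comm]
  gcongr
  exact hC ξ

end SchwartzGagliardo

/-! ### Bessel potentials of Schwartz functions -/

section SchwartzBessel

variable {E F : Type*} [NormedAddCommGroup E] [InnerProductSpace ℝ E] [FiniteDimensional ℝ E]
  [MeasurableSpace E] [BorelSpace E] [NormedAddCommGroup F] [InnerProductSpace ℂ F]
  [CompleteSpace F]

/-- The Bessel potential `⟨D⟩ᵗ` on Schwartz functions, the restriction of
`TemperedDistribution.besselPotential`. -/
def schwartzBessel (t : ℝ) : 𝓢(E, F) →L[ℂ] 𝓢(E, F) :=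
  SchwartzMap.fourierMultiplierCLM F (fun x : E => (((1 + ‖x‖ ^ 2) ^ (t / 2) : ℝ) : ℂ))

theorem fourier_schwartzBessel_apply (t : ℝ) (f : 𝓢(E, F)) (ξ : E) :
    𝓕 (schwartzBessel t f) ξ = (((1 + ‖ξ‖ ^ 2) ^ (t / 2) : ℝ) : ℂ) • 𝓕 f ξ := by
  rw [schwartzBessel, SchwartzMap.fourierMultiplierCLM_apply,
    FourierTransform.fourier_fourierInv_eq, SchwartzMap.smulLeftCLM_apply_apply (by fun_prop)]

theorem schwartzBessel_schwartzBessel_neg (t : ℝ) (f : 𝓢(E, F)) :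
    schwartzBessel t (schwartzBessel (-t) f) = f := by
  rw [schwartzBessel, schwartzBessel,
    SchwartzMap.fourierMultiplierCLM_fourierMultiplierCLM_apply (by fun_prop) (by fun_prop)]
  have hone : ((fun x : E => (((1 + ‖x‖ ^ 2) ^ (t / 2) : ℝ) : ℂ)) *
      fun x : E => (((1 + ‖x‖ ^ 2) ^ (-t / 2) : ℝ) : ℂ)) = fun _ => 1 := by
    ext x
    rw [Pi.mul_apply, ← Complex.ofReal_mul, ← Real.rpow_add (by positivity)]
    simp [neg_div]
  rw [hone, SchwartzMap.fourierMultiplierCLM_const, one_smul]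
  rfl

theorem besselPotential_toTemperedDistribution (t : ℝ) (f : 𝓢(E, F)) :
    TemperedDistribution.besselPotential E F t
        ((f.toLp 2 : Lp F 2 (volume : Measure E)) : 𝓢'(E, F)) =
      (((schwartzBessel t f).toLp 2 : Lp F 2 (volume : Measure E)) : 𝓢'(E, F)) := by
  rw [TemperedDistribution.besselPotential, Lp.toTemperedDistribution_toLp_eq,
    Lp.toTemperedDistribution_toLp_eq,
    TemperedDistribution.fourierMultiplierCLM_toTemperedDistributionCLM_eq (by fun_prop)]
  rfl

theorem lintegral_norm_rpow_mul_fourier_le {σ t : ℝ} (hσ : 0 ≤ σ) (hσt : σ ≤ t) (f : 𝓢(E, F)) :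
    ∫⁻ ξ, ENNReal.ofReal (‖ξ‖ ^ (2 * σ)) * ‖𝓕 f ξ‖ₑ ^ 2 ≤
      eLpNorm (schwartzBessel t f) 2 volume ^ 2 := by
  rw [← eLpNorm_fourier_eq, eLpNorm_two_sq]
  refine lintegral_mono fun ξ => ?_
  rw [fourier_schwartzBessel_apply, enorm_smul, mul_pow]
  gcongr
  rw [← ofReal_norm, Complex.norm_real, Real.norm_of_nonneg (by positivity),
    ← ENNReal.ofReal_pow (by positivity)]
  refine ENNReal.ofReal_le_ofReal ?_
  calc ‖ξ‖ ^ (2 * σ) = (‖ξ‖ ^ 2) ^ σ := by rw [Real.rpow_mul (norm_nonneg _), Real.rpow_ofNat]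
    _ ≤ (1 + ‖ξ‖ ^ 2) ^ σ := by gcongr; linarith
    _ ≤ (1 + ‖ξ‖ ^ 2) ^ t := Real.rpow_le_rpow_of_exponent_le (by linarith [sq_nonneg ‖ξ‖]) hσt
    _ = ((1 + ‖ξ‖ ^ 2) ^ (t / 2)) ^ 2 := by
        rw [← Real.rpow_mul_natCast (by positivity)]
        norm_num

theorem eLpNorm_le_schwartzBessel {t : ℝ} (ht : 0 ≤ t) (f : 𝓢(E, F)) :
    eLpNorm f 2 volume ≤ eLpNorm (schwartzBessel t f) 2 volume := by
  rw [← ENNReal.pow_le_pow_left_iff two_ne_zero, ← eLpNorm_fourier_eq f, eLpNorm_two_sq]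
  simpa using lintegral_norm_rpow_mul_fourier_le le_rfl ht f

theorem gagliardo_le_schwartzBessel [Nontrivial E] {σ t : ℝ} (hσ : σ ∈ Set.Ioo (0 : ℝ) 1)
    (hσt : σ ≤ t) : ∃ C : ℝ≥0, ∀ f : 𝓢(E, F),
      gagliardo σ f volume ≤ C * eLpNorm (schwartzBessel t f) 2 volume := by
  obtain ⟨C, hC⟩ := gagliardo_sq_le_lintegral_fourier (E := E) (F := F) hσ
  refine ⟨NNReal.sqrt C, fun f => ?_⟩
  rw [← ENNReal.pow_le_pow_left_iff two_ne_zero, mul_pow, ← ENNReal.coe_pow, NNReal.sq_sqrt]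
  refine (hC f).trans ?_
  gcongr
  exact lintegral_norm_rpow_mul_fourier_le hσ.1.le hσt f

end SchwartzBessel

section HsNorm

variable {E F : Type*} [NormedAddCommGroup E] [InnerProductSpace ℝ E] [FiniteDimensional ℝ E]
  [MeasurableSpace E] [BorelSpace E] [NormedAddCommGroup F] {s r : ℝ}

/-- The norm of `L^{2r} ∩ Ḣˢ`. The Sobolev inequality embeds `Hˢ` in this space, and the magnetic
forms are bounded on it. -/
def hsNorm [NormedSpace ℝ F] (s r : ℝ) (u : E → F) : ℝ≥0∞ :=
  eLpNorm u (ENNReal.ofReal (2 * r)) volume + gagliardo s u volume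

theorem hsNorm_add_le [NormedSpace ℝ F] (hr : 1 ≤ r) {u v : E → F}
    (hu : AEStronglyMeasurable u) (hv : AEStronglyMeasurable v) :
    hsNorm s r (u + v) ≤ hsNorm s r u + hsNorm s r v := by
  rw [hsNorm, hsNorm, hsNorm, add_add_add_comm]
  exact add_le_add (eLpNorm_add_le hu hv (by rw [ENNReal.one_le_ofReal]; linarith))
    (gagliardo_add_le hu hv)

theorem hsNorm_schwartz_le [Nontrivial E] [InnerProductSpace ℂ F] [CompleteSpace F] {p p' : ℝ}
    (hs : s ∈ Set.Ioo (0 : ℝ) 1) (hp : p.HolderConjugate p')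
    (hsp : (Module.finrank ℝ E : ℝ) ≤ 2 * s * p) :
    ∃ C : ℝ≥0, ∀ f : 𝓢(E, F), hsNorm s p' f ≤ C * eLpNorm (schwartzBessel s f) 2 volume := by
  have hσs : (Module.finrank ℝ E : ℝ) / (2 * p) ≤ s := by
    rw [div_le_iff₀ (by linarith [hp.pos])]
    linarith
  have hσ : (Module.finrank ℝ E : ℝ) / (2 * p) ∈ Set.Ioo (0 : ℝ) 1 :=
    ⟨div_pos (by exact_mod_cast Module.finrank_pos) (by linarith [hp.pos]), hσs.trans_lt hs.2⟩
  obtain ⟨C₁, hC₁⟩ := eLpNorm_le_gagliardo (E := E) (F := F) volume hp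
  obtain ⟨C₂, hC₂⟩ := gagliardo_le_schwartzBessel (E := E) (F := F) hσ hσs
  obtain ⟨C₃, hC₃⟩ := gagliardo_le_schwartzBessel (E := E) (F := F) hs le_rfl
  refine ⟨C₁ * C₂ + C₃, fun f => ?_⟩
  calc hsNorm s p' f
      ≤ C₁ * gagliardo ((Module.finrank ℝ E : ℝ) / (2 * p)) f volume + gagliardo s f volume := by
        rw [hsNorm]
        gcongr
        exact hC₁ f f.continuous.aestronglyMeasurable (f.eLpNorm_lt_top _ volume).ne
    _ ≤ C₁ * (C₂ * eLpNorm (schwartzBessel s f) 2 volume) +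
        C₃ * eLpNorm (schwartzBessel s f) 2 volume := by
        gcongr
        · exact hC₂ f
        · exact hC₃ f
    _ = ↑(C₁ * C₂ + C₃) * eLpNorm (schwartzBessel s f) 2 volume := by
        push_cast
        ring

theorem eLpNorm_le_of_tendsto_ae {α : Type*} [MeasurableSpace α] {μ : Measure α} {q M : ℝ≥0∞}
    {f : ℕ → α → F} {u : α → F} (hf : ∀ k, AEStronglyMeasurable (f k) μ)
    (hM : ∀ k, eLpNorm (f k) q μ ≤ M) (hlim : ∀ᵐ x ∂μ, Tendsto (f · x) atTop (𝓝 (u x))) :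
    eLpNorm u q μ ≤ M :=
  (Lp.eLpNorm_lim_le_liminf_eLpNorm hf u hlim).trans
    (liminf_le_of_frequently_le' (Frequently.of_forall hM))

theorem gagliardo_le_of_tendsto_ae [NormedSpace ℝ F] {M : ℝ≥0∞} {f : ℕ → E → F} {u : E → F}
    (hf : ∀ k, AEStronglyMeasurable (f k)) (hM : ∀ k, gagliardo s (f k) volume ≤ M)
    (hlim : ∀ᵐ x, Tendsto (f · x) atTop (𝓝 (u x))) : gagliardo s u volume ≤ M := by
  refine eLpNorm_le_of_tendsto_ae (fun k => aestronglyMeasurable_quotient (hf k) _) hM ?_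
  filter_upwards [Measure.quasiMeasurePreserving_fst.ae hlim,
    Measure.quasiMeasurePreserving_snd.ae hlim] with z hz₁ hz₂
  exact (hz₁.sub hz₂).const_smul _

theorem hsNorm_le_of_tendsto_ae [NormedSpace ℝ F] {M : ℝ≥0∞} {f : ℕ → E → F} {u : E → F}
    (hf : ∀ k, AEStronglyMeasurable (f k)) (hM : ∀ k, hsNorm s r (f k) ≤ M)
    (hlim : ∀ᵐ x, Tendsto (f · x) atTop (𝓝 (u x))) : hsNorm s r u ≤ 2 * M := by
  rw [two_mul]
  exact add_le_add
    (eLpNorm_le_of_tendsto_ae hf (fun k => le_self_add.trans (hM k)) hlim)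
    (gagliardo_le_of_tendsto_ae hf (fun k => le_add_self.trans (hM k)) hlim)

end HsNorm

section Approximation

variable {E F : Type*} [NormedAddCommGroup E] [InnerProductSpace ℝ E] [FiniteDimensional ℝ E]
  [MeasurableSpace E] [BorelSpace E] [NormedAddCommGroup F] [InnerProductSpace ℂ F]
  {s t : ℝ}

theorem denseRange_toLp : DenseRange fun g : 𝓢(E, F) => g.toLp 2 (volume : Measure E) :=
  SchwartzMap.denseRange_toLpCLM (F := F) (μ := (volume : Measure E)) ENNReal.ofNat_ne_top

theorem edist_toLp (f g : 𝓢(E, F)) :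
    edist (f.toLp 2 (volume : Measure E)) (g.toLp 2 volume) =
      eLpNorm (f - g : 𝓢(E, F)) 2 volume := by
  rw [Lp.edist_def]
  refine eLpNorm_congr_ae ?_
  filter_upwards [f.coeFn_toLp 2 volume, g.coeFn_toLp 2 volume] with x hf hg
  rw [Pi.sub_apply, hf, hg, sub_apply]

variable [CompleteSpace F]

theorem exists_clm_schwartzBessel_neg (ht : 0 ≤ t) :
    ∃ T : Lp F 2 (volume : Measure E) →L[ℂ] Lp F 2 (volume : Measure E),
      ∀ g : 𝓢(E, F), T (g.toLp 2) = (schwartzBessel (-t) g).toLp 2 := by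
  refine ⟨((SchwartzMap.toLpCLM ℂ F 2 (volume : Measure E)).toLinearMap ∘ₗ
    (schwartzBessel (-t) : 𝓢(E, F) →L[ℂ] 𝓢(E, F)).toLinearMap).extendOfNorm
      (SchwartzMap.toLpCLM ℂ F 2 (volume : Measure E)).toLinearMap, fun g => ?_⟩
  refine LinearMap.extendOfNorm_eq (denseRange_toLp (E := E) (F := F)) ⟨1, fun f => ?_⟩ g
  rw [one_mul]
  change ‖(schwartzBessel (-t) f).toLp (2 : ℝ≥0∞) (volume : Measure E)‖ ≤
    ‖f.toLp (2 : ℝ≥0∞) (volume : Measure E)‖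
  rw [SchwartzMap.norm_toLp, SchwartzMap.norm_toLp]
  refine ENNReal.toReal_mono (f.eLpNorm_lt_top 2 volume).ne ?_
  simpa only [schwartzBessel_schwartzBessel_neg] using
    eLpNorm_le_schwartzBessel ht (schwartzBessel (-t) f)

theorem toTemperedDistribution_eq_besselPotential_neg
    {T : Lp F 2 (volume : Measure E) →L[ℂ] Lp F 2 (volume : Measure E)}
    (hT : ∀ g : 𝓢(E, F), T (g.toLp 2) = (schwartzBessel (-t) g).toLp 2)
    (w : Lp F 2 (volume : Measure E)) :
    (T w : 𝓢'(E, F)) = TemperedDistribution.besselPotential E F (-t) (w : 𝓢'(E, F)) := by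
  have hemb := (Lp.toTemperedDistributionCLM F (volume : Measure E) 2).continuous
  have hclosed : IsClosed {w : Lp F 2 (volume : Measure E) | (T w : 𝓢'(E, F)) =
      TemperedDistribution.besselPotential E F (-t) (w : 𝓢'(E, F))} :=
    isClosed_eq (hemb.comp T.continuous)
      ((TemperedDistribution.besselPotential E F (-t)).continuous.comp hemb)
  refine denseRange_toLp.induction_on w hclosed fun g => ?_
  rw [hT, besselPotential_toTemperedDistribution]

theorem toTemperedDistribution_injective :
    Function.Injective fun w : Lp F 2 (volume : Measure E) => (w : 𝓢'(E, F)) :=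
  LinearMap.ker_eq_bot.1 Lp.ker_toTemperedDistributionCLM_eq_bot

theorem MemH.exists_tendsto_toLp {u : E → F} (ht : 0 ≤ t) (hu : MemH t u) :
    ∃ f : ℕ → 𝓢(E, F), CauchySeq (fun k => (schwartzBessel t (f k)).toLp 2 (volume : Measure E)) ∧
      Tendsto (fun k => (f k).toLp 2 volume) atTop (𝓝 (hu.choose.toLp u)) := by
  obtain ⟨w, hw⟩ := hu.choose_spec
  obtain ⟨T, hT⟩ := exists_clm_schwartzBessel_neg (E := E) (F := F) ht
  obtain ⟨y, hy, hyw⟩ := mem_closure_iff_seq_limit.1 (denseRange_toLp w)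
  choose g hg using hy
  have hgw : Tendsto (fun k => (g k).toLp 2 (volume : Measure E)) atTop (𝓝 w) :=
    hyw.congr fun k => (hg k).symm
  refine ⟨fun k => schwartzBessel (-t) (g k), ?_, ?_⟩
  · simpa only [schwartzBessel_schwartzBessel_neg] using hgw.cauchySeq
  · have hTw : T w = hu.choose.toLp u := by
      refine toTemperedDistribution_injective ?_
      dsimp only
      rw [toTemperedDistribution_eq_besselPotential_neg hT]
      exact (TemperedDistribution.besselPotential_neg_apply_eq_iff t _ _).2 hw
    simpa only [Function.comp_def, hT, hTw] using (T.continuous.tendsto w).comp hgw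

theorem MemH.exists_tendsto_ae {u : E → F} (ht : 0 ≤ t) (hu : MemH t u) :
    ∃ f : ℕ → 𝓢(E, F), CauchySeq (fun k => (schwartzBessel t (f k)).toLp 2 (volume : Measure E)) ∧
      ∀ᵐ x, Tendsto (f · x) atTop (𝓝 (u x)) := by
  obtain ⟨f, hcauchy, hlim⟩ := hu.exists_tendsto_toLp ht
  have hmeas : TendstoInMeasure volume (fun k => (f k : E → F)) atTop u :=
    (tendstoInMeasure_of_tendsto_Lp hlim).congr' (.of_forall fun k => (f k).coeFn_toLp _ _)
      hu.choose.coeFn_toLp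
  obtain ⟨φ, hφ, hae⟩ := hmeas.exists_seq_tendsto_ae
  exact ⟨f ∘ φ, hcauchy.comp_tendsto hφ.tendsto_atTop, hae⟩

theorem MemH.exists_schwartz_hsNorm_sub_le [Nontrivial E] {p p' : ℝ}
    (hs : s ∈ Set.Ioo (0 : ℝ) 1) (hp : p.HolderConjugate p')
    (hsp : (Module.finrank ℝ E : ℝ) ≤ 2 * s * p) {u : E → F} (hu : MemH s u) {ε : ℝ≥0∞}
    (hε : ε ≠ 0) : ∃ f : 𝓢(E, F), hsNorm s p' (u - ⇑f) ≤ ε := by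
  obtain ⟨C, hC⟩ := hsNorm_schwartz_le (E := E) (F := F) hs hp hsp
  obtain ⟨f, hcauchy, hlim⟩ := hu.exists_tendsto_ae hs.1.le
  have hδ : ε / (2 * (C + 1)) ≠ 0 := ENNReal.div_ne_zero.2 ⟨hε, by finiteness⟩
  obtain ⟨N, hN⟩ := EMetric.cauchySeq_iff.1 hcauchy _ (pos_iff_ne_zero.2 hδ)
  have hbound : ∀ k, hsNorm s p' (⇑(f (k + N)) - ⇑(f N)) ≤ C * (ε / (2 * (C + 1))) := by
    intro k
    refine (hC (f (k + N) - f N)).trans ?_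
    gcongr
    refine le_trans (le_of_eq ?_) (hN (k + N) (Nat.le_add_left N k) N le_rfl).le
    rw [map_sub]
    exact (edist_toLp _ _).symm
  refine ⟨f N, (hsNorm_le_of_tendsto_ae (fun k => ((f (k + N)).continuous.sub
    (f N).continuous).aestronglyMeasurable) hbound ?_).trans ?_⟩
  · filter_upwards [hlim] with x hx
    exact ((tendsto_add_atTop_iff_nat N).2 hx).sub_const _
  · calc 2 * (C * (ε / (2 * (C + 1)))) ≤ 2 * (C + 1) * (ε / (2 * (C + 1))) := by
          rw [← mul_assoc]
          gcongr
          exact le_self_add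
      _ ≤ ε := ENNReal.mul_div_le

end Approximation

section CompactSupport

variable {E F : Type*} [NormedAddCommGroup E] [NormedSpace ℝ E] [FiniteDimensional ℝ E]
  [NormedAddCommGroup F] [NormedSpace ℝ F]

theorem exists_norm_iteratedFDeriv_one_sub_comp_smul_le (χ : ContDiffBump (0 : E)) (i : ℕ) :
    ∃ C, 0 ≤ C ∧ ∀ R : ℝ, 1 ≤ R → ∀ x,
      ‖iteratedFDeriv ℝ i (fun y => 1 - χ (R⁻¹ • y)) x‖ ≤ C * (‖x‖ / R) := by
  let η : E → ℝ := fun y => 1 - χ y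
  have hη : ContDiff ℝ ∞ η := contDiff_const.sub χ.contDiff
  obtain ⟨C, hC⟩ : ∃ C, ∀ x, ‖iteratedFDeriv ℝ i η x‖ ≤ C := by
    have hχ : ContDiff ℝ ∞ fun y => χ y := χ.contDiff
    obtain ⟨C, hC⟩ := (χ.hasCompactSupport.iteratedFDeriv i).exists_bound_of_continuous
      (hχ.continuous_iteratedFDeriv (mod_cast le_top) : Continuous (iteratedFDeriv ℝ i χ))
    refine ⟨1 + C, fun x => ?_⟩
    have hsub : η = (fun _ => 1) - ⇑χ := rfl
    rw [hsub, iteratedFDeriv_sub_apply contDiffAt_const (hχ.contDiffAt.of_le (mod_cast le_top))]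
    refine (norm_sub_le _ _).trans (add_le_add ?_ (hC x))
    rcases i with _ | i
    · simp
    · simp [iteratedFDeriv_succ_const]
  have hC0 : 0 ≤ C := (norm_nonneg _).trans (hC 0)
  refine ⟨C / χ.rIn, div_nonneg hC0 χ.rIn_pos.le, fun R hR x => ?_⟩
  have hR0 : 0 < R := one_pos.trans_le hR
  change ‖iteratedFDeriv ℝ i (fun y => η (R⁻¹ • y)) x‖ ≤ _
  rw [iteratedFDeriv_comp_const_smul R⁻¹ (hη.of_le (mod_cast le_top)), norm_smul]
  rcases lt_or_ge ‖R⁻¹ • x‖ χ.rIn with hx | hx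
  · have hη0 : η =ᶠ[𝓝 (R⁻¹ • x)] fun _ => 0 := by
      filter_upwards [Metric.isOpen_ball.mem_nhds (mem_ball_zero_iff.2 hx)] with y hy
      exact sub_eq_zero.2 (χ.one_of_mem_closedBall (Metric.ball_subset_closedBall hy)).symm
    rw [(hη0.iteratedFDeriv ℝ i).eq_of_nhds, iteratedFDeriv_fun_zero]
    simp only [Pi.zero_apply, norm_zero, mul_zero]
    have := χ.rIn_pos
    positivity
  · rw [norm_smul, norm_inv, Real.norm_of_nonneg hR0.le] at hx
    calc ‖R⁻¹ ^ i‖ * ‖iteratedFDeriv ℝ i η (R⁻¹ • x)‖ ≤ 1 * C := by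
          gcongr
          · rw [norm_pow, norm_inv, Real.norm_of_nonneg hR0.le]
            exact pow_le_one₀ (by positivity) (inv_le_one_of_one_le₀ hR)
          · exact hC _
      _ = C / χ.rIn * χ.rIn := by rw [one_mul, div_mul_cancel₀ _ χ.rIn_pos.ne']
      _ ≤ C / χ.rIn * (‖x‖ / R) := by
          rw [div_eq_inv_mul ‖x‖]
          have := χ.rIn_pos
          gcongr

theorem exists_seminorm_one_sub_smul_le (χ : ContDiffBump (0 : E)) (f : 𝓢(E, F)) (k m : ℕ) :
    ∃ C, ∀ R : ℝ, 1 ≤ R → ∀ x,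
      ‖x‖ ^ k * ‖iteratedFDeriv ℝ m (fun y => (1 - χ (R⁻¹ • y)) • f y) x‖ ≤ C / R := by
  choose C hC0 hC using exists_norm_iteratedFDeriv_one_sub_comp_smul_le χ
  refine ⟨∑ i ∈ Finset.range (m + 1), m.choose i * C i * SchwartzMap.seminorm ℝ (k + 1) (m - i) f,
    fun R hR x => ?_⟩
  have hχ : ContDiff ℝ ∞ fun y : E => 1 - χ (R⁻¹ • y) :=
    contDiff_const.sub (χ.contDiff.comp (contDiff_const_smul _))
  have : 0 < R := one_pos.trans_le hR
  calc ‖x‖ ^ k * ‖iteratedFDeriv ℝ m (fun y => (1 - χ (R⁻¹ • y)) • f y) x‖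
      ≤ ‖x‖ ^ k * ∑ i ∈ Finset.range (m + 1), m.choose i *
          ‖iteratedFDeriv ℝ i (fun y => 1 - χ (R⁻¹ • y)) x‖ * ‖iteratedFDeriv ℝ (m - i) f x‖ := by
        gcongr
        exact norm_iteratedFDeriv_smul_le hχ f.smooth' x (mod_cast le_top)
    _ ≤ ‖x‖ ^ k * ∑ i ∈ Finset.range (m + 1), m.choose i *
          (C i * (‖x‖ / R)) * ‖iteratedFDeriv ℝ (m - i) f x‖ := by
        gcongr with i
        exact hC i R hR x
    _ = ∑ i ∈ Finset.range (m + 1), m.choose i * C i *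
          (‖x‖ ^ (k + 1) * ‖iteratedFDeriv ℝ (m - i) f x‖) / R := by
        rw [Finset.mul_sum]
        exact Finset.sum_congr rfl fun i _ => by ring
    _ ≤ _ := by
        rw [Finset.sum_div]
        gcongr with i
        · exact mul_nonneg (Nat.cast_nonneg _) (hC0 i)
        · exact SchwartzMap.le_seminorm ℝ (k + 1) (m - i) f x

theorem dense_hasCompactSupport : Dense {f : 𝓢(E, F) | HasCompactSupport f} := by
  intro f
  let χ : ContDiffBump (0 : E) := ⟨1, 2, one_pos, one_lt_two⟩
  have hcompact (R : ℝ) (hR : 0 < R) : HasCompactSupport fun x => χ (R⁻¹ • x) • f x :=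
    (χ.hasCompactSupport.comp_smul (inv_ne_zero hR.ne')).smul_right
  have hsmooth (R : ℝ) : ContDiff ℝ ∞ fun x => χ (R⁻¹ • x) • f x :=
    (χ.contDiff.comp (contDiff_const_smul _)).smul f.smooth'
  let g : ℕ → 𝓢(E, F) := fun N =>
    (hcompact (N + 1) N.cast_add_one_pos).toSchwartzMap (hsmooth (N + 1))
  refine mem_closure_of_tendsto (f := g) (b := atTop) ?_
    (.of_forall fun N => hcompact (N + 1) N.cast_add_one_pos)
  rw [(schwartz_withSeminorms ℝ E F).tendsto_nhds]
  rintro ⟨k, m⟩ ε hε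
  obtain ⟨C, hC⟩ := exists_seminorm_one_sub_smul_le χ f k m
  have hC0 : 0 ≤ C := (by positivity : (0 : ℝ) ≤ _).trans ((hC 1 le_rfl 0).trans_eq (div_one C))
  have hlim : Tendsto (fun N : ℕ => C / (N + 1 : ℝ)) atTop (𝓝 0) :=
    tendsto_const_nhds.div_atTop (tendsto_natCast_atTop_atTop.atTop_add tendsto_const_nhds)
  filter_upwards [hlim.eventually_lt_const hε] with N hN
  refine lt_of_le_of_lt ?_ hN
  rw [map_sub_rev]
  refine SchwartzMap.seminorm_le_bound ℝ k m _ (by positivity) fun x => ?_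
  have hsub : ⇑(f - g N) = fun y => (1 - χ ((N + 1 : ℝ)⁻¹ • y)) • f y := by
    ext y
    change f y - χ ((N + 1 : ℝ)⁻¹ • y) • f y = _
    rw [sub_smul, one_smul]
  rw [hsub]
  exact hC (N + 1) (by linarith [N.cast_nonneg (α := ℝ)]) x

end CompactSupport

section SobolevDensity

variable {E F : Type*} [NormedAddCommGroup E] [InnerProductSpace ℝ E] [FiniteDimensional ℝ E]
  [MeasurableSpace E] [BorelSpace E] [NormedAddCommGroup F] [InnerProductSpace ℂ F]
  [CompleteSpace F] {s t p p' : ℝ} {u : E → F}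

theorem memH_of_contDiff {φ : E → F} (hφ : ContDiff ℝ ∞ φ) (hφc : HasCompactSupport φ) :
    MemH t φ := by
  let f : 𝓢(E, F) := hφc.toSchwartzMap hφ
  refine ⟨f.memLp 2 volume, ?_⟩
  have hf := f.memSobolev (s := t) (p := 2)
  rwa [← Lp.toTemperedDistribution_toLp_eq (p := 2)] at hf

variable [Nontrivial E]

theorem exists_contDiff_hsNorm_schwartz_sub_le
    (hs : s ∈ Set.Ioo (0 : ℝ) 1) (hp : p.HolderConjugate p')
    (hsp : (Module.finrank ℝ E : ℝ) ≤ 2 * s * p) (f : 𝓢(E, F)) {ε : ℝ≥0∞} (hε : ε ≠ 0) :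
    ∃ φ : E → F, ContDiff ℝ ∞ φ ∧ HasCompactSupport φ ∧ hsNorm s p' (⇑f - φ) ≤ ε := by
  obtain ⟨C, hC⟩ := hsNorm_schwartz_le (E := E) (F := F) hs hp hsp
  have hcont : Tendsto (fun φ : 𝓢(E, F) => C * eLpNorm (schwartzBessel s (f - φ)) 2 volume)
      (𝓝 f) (𝓝 0) := by
    have hL2 : Continuous fun φ => (schwartzBessel s φ).toLp 2 (volume : Measure E) :=
      ((SchwartzMap.toLpCLM ℂ F 2 (volume : Measure E)).comp (schwartzBessel s)).continuous
    have hlim := ENNReal.Tendsto.const_mul (((continuous_const (y := (schwartzBessel s f).toLp 2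
      (volume : Measure E))).edist hL2).tendsto f) (.inr (ENNReal.coe_ne_top (r := C)))
    simpa only [edist_toLp, ← map_sub, sub_self, map_zero, edist_self, mul_zero] using hlim
  obtain ⟨φ, hφ, hφf⟩ := mem_closure_iff_nhds.1 (dense_hasCompactSupport f)
    _ (hcont.eventually_le_const (pos_iff_ne_zero.2 hε))
  exact ⟨φ, φ.smooth', hφf, (hC (f - φ)).trans hφ⟩

theorem MemH.exists_contDiff_hsNorm_sub_le
    (hs : s ∈ Set.Ioo (0 : ℝ) 1) (hp : p.HolderConjugate p')
    (hsp : (Module.finrank ℝ E : ℝ) ≤ 2 * s * p) (hu : MemH s u) {ε : ℝ≥0∞} (hε : ε ≠ 0) :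
    ∃ φ : E → F, ContDiff ℝ ∞ φ ∧ HasCompactSupport φ ∧ hsNorm s p' (u - φ) ≤ ε := by
  have hε2 : ε / 2 ≠ 0 := (ENNReal.half_pos hε).ne'
  obtain ⟨f, hf⟩ := hu.exists_schwartz_hsNorm_sub_le hs hp hsp hε2
  obtain ⟨φ, hφ, hφc, hfφ⟩ := exists_contDiff_hsNorm_schwartz_sub_le hs hp hsp f hε2
  refine ⟨φ, hφ, hφc, ?_⟩
  calc hsNorm s p' (u - φ) = hsNorm s p' ((u - ⇑f) + (⇑f - φ)) := by rw [sub_add_sub_cancel]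
    _ ≤ hsNorm s p' (u - ⇑f) + hsNorm s p' (⇑f - φ) :=
        hsNorm_add_le hp.symm.lt.le (hu.choose.1.sub f.continuous.aestronglyMeasurable)
          (f.continuous.sub hφ.continuous).aestronglyMeasurable
    _ ≤ ε / 2 + ε / 2 := add_le_add hf hfφ
    _ = ε := ENNReal.add_halves ε

theorem MemH.hsNorm_lt_top (hs : s ∈ Set.Ioo (0 : ℝ) 1) (hp : p.HolderConjugate p')
    (hsp : (Module.finrank ℝ E : ℝ) ≤ 2 * s * p) (hu : MemH s u) : hsNorm s p' u < ⊤ := by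
  obtain ⟨C, hC⟩ := hsNorm_schwartz_le (E := E) (F := F) hs hp hsp
  obtain ⟨f, hf⟩ := hu.exists_schwartz_hsNorm_sub_le hs hp hsp one_ne_zero
  have hfm : AEStronglyMeasurable f (volume : Measure E) := f.continuous.aestronglyMeasurable
  calc hsNorm s p' u = hsNorm s p' ((u - ⇑f) + ⇑f) := by rw [sub_add_cancel]
    _ ≤ hsNorm s p' (u - ⇑f) + hsNorm s p' f :=
        hsNorm_add_le hp.symm.lt.le (hu.choose.1.sub hfm) hfm
    _ ≤ 1 + C * eLpNorm (schwartzBessel s f) 2 volume := add_le_add hf (hC f)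
    _ < ⊤ := by
        have := (schwartzBessel s f).eLpNorm_lt_top 2 (volume : Measure E)
        finiteness

end SobolevDensity

section FracGrad

variable {n : ℕ} {s : ℝ}

theorem norm_toC (a : RSpace n) : ‖toC a‖ = ‖a‖ := by
  simp [toC, EuclideanSpace.norm_eq]

theorem toC_smul (c : ℝ) (a : RSpace n) : toC (c • a) = (c : ℂ) • toC a := by
  ext i
  simp [toC]

theorem continuous_toC : Continuous (toC : RSpace n → CSpace n) :=
  (PiLp.continuous_toLp 2 _).comp (continuous_pi fun i => by fun_prop)

theorem fracConst_pos (hn : 1 ≤ n) (hs : s ∈ Set.Ioo (0 : ℝ) 1) : 0 < fracConst n s := by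
  have hnum : 0 < Real.Gamma ((n : ℝ) / 2 + s) :=
    Real.Gamma_pos_of_pos (add_pos_of_nonneg_of_pos (by positivity) hs.1)
  have hden : Real.Gamma (-s) ≠ 0 := by
    refine Real.Gamma_ne_zero fun m hm => ?_
    have hsm : s = m := neg_injective hm
    have hm0 : 0 < m := Nat.cast_pos.1 (hsm ▸ hs.1)
    exact hm0.ne' (Nat.cast_lt_one.1 (hsm ▸ hs.2))
  unfold fracConst
  positivity

theorem alpha_eq_smul (s : ℝ) (z : RSpace n × RSpace n) :
    alpha s z = ((-(√(fracConst n s) / √2 / ‖z.2 - z.1‖ ^ ((n : ℝ) / 2 + s + 1)) : ℝ) : ℂ) •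
      toC (z.1 - z.2) := by
  rw [← toC_smul, alpha, ← neg_sub z.1 z.2, smul_neg, neg_smul, norm_neg]

theorem norm_alpha (hs : 0 < s) (z : RSpace n × RSpace n) :
    ‖alpha s z‖ = √(fracConst n s) / √2 * ‖z.1 - z.2‖ ^ (-((n : ℝ) / 2 + s)) := by
  rw [alpha, norm_toC, norm_smul, Real.norm_of_nonneg (by positivity), norm_sub_rev]
  rcases (norm_nonneg (z.1 - z.2)).eq_or_lt with h | h
  · rw [← h, Real.zero_rpow (x := -((n : ℝ) / 2 + s)) (by have := n.cast_nonneg (α := ℝ); linarith),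
      mul_zero, mul_zero]
  · rw [Real.rpow_neg h.le, Real.rpow_add_one h.ne']
    field_simp

theorem alpha_swap (z : RSpace n × RSpace n) : alpha s z.swap = -alpha s z := by
  rw [alpha_eq_smul, alpha, Prod.fst_swap, Prod.snd_swap, norm_sub_rev, toC_smul,
    Complex.ofReal_neg, neg_smul]

theorem aestronglyMeasurable_alpha :
    AEStronglyMeasurable (alpha s : RSpace n × RSpace n → CSpace n) := by
  refine (continuous_toC.measurable.comp ?_).aestronglyMeasurable
  fun_prop

theorem aestronglyMeasurable_fracGrad {u : RSpace n → ℂ} (hu : AEStronglyMeasurable u) :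
    AEStronglyMeasurable (fracGrad s u) :=
  (hu.comp_fst.sub hu.comp_snd).smul aestronglyMeasurable_alpha

theorem eLpNorm_fracGrad (hs : 0 < s) (u : RSpace n → ℂ) :
    eLpNorm (fracGrad s u) 2 = ‖√(fracConst n s) / √2‖ₑ * gagliardo s u volume := by
  rw [gagliardo, ← eLpNorm_const_smul, Measure.volume_eq_prod]
  refine eLpNorm_congr_norm_ae (.of_forall fun z => ?_)
  rw [fracGrad, norm_smul, norm_alpha hs, Pi.smul_apply, norm_smul, norm_smul,
    Real.norm_of_nonneg (by positivity), Real.norm_of_nonneg (by positivity),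
    finrank_euclideanSpace_fin, mul_comm, mul_assoc]

theorem eLpNorm_fracGrad_le_hsNorm (hs : 0 < s) (r : ℝ) (u : RSpace n → ℂ) :
    eLpNorm (fracGrad s u) 2 ≤ ‖√(fracConst n s) / √2‖ₑ * hsNorm s r u :=
  (eLpNorm_fracGrad hs u).trans_le (mul_le_mul_right le_add_self _)

end FracGrad

section Multipliers

variable {E G : Type*} [MeasureSpace E] [NormedAddCommGroup G] [NormedSpace ℂ G]

theorem eLpNorm_fst_smul_le {α β : Type*} [MeasurableSpace α] [MeasurableSpace β] {μ : Measure α}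
    {ν : Measure β} [SFinite ν] {p p' : ℝ} (hp : p.HolderConjugate p') {u : α → ℂ}
    (hu : AEStronglyMeasurable u μ) {B : α × β → G} (hB : AEStronglyMeasurable B (μ.prod ν)) :
    eLpNorm (fun z => u z.1 • B z) 2 (μ.prod ν) ≤ eLpNorm u (ENNReal.ofReal (2 * p')) μ *
      (∫⁻ x, ((∫⁻ y, ‖B (x, y)‖ₑ ^ 2 ∂ν) ^ (1 / 2 : ℝ)) ^ (2 * p) ∂μ) ^ (1 / (2 * p)) := by
  have hp0' : 0 < 2 * p' := mul_pos two_pos hp.symm.pos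
  have hsection (x : α) : ∫⁻ y, ‖u x • B (x, y)‖ₑ ^ 2 ∂ν =
      (‖u x‖ₑ * (∫⁻ y, ‖B (x, y)‖ₑ ^ 2 ∂ν) ^ (1 / 2 : ℝ)) ^ (2 : ℝ) := by
    rw [ENNReal.mul_rpow_of_nonneg _ _ zero_le_two, ← ENNReal.rpow_mul,
      one_div_mul_cancel two_ne_zero, ENNReal.rpow_one, ENNReal.rpow_two,
      ← lintegral_const_mul' _ _ (by finiteness)]
    simp_rw [enorm_smul, mul_pow]
  have hexp : 1 / (2 : ℝ) = 1 / (2 * p') + 1 / (2 * p) := by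
    have := hp.symm.inv_add_inv_eq_one
    simp only [one_div, mul_inv, ← mul_add, this, mul_one]
  calc eLpNorm (fun z => u z.1 • B z) 2 (μ.prod ν)
      = (∫⁻ x, ∫⁻ y, ‖u x • B (x, y)‖ₑ ^ 2 ∂ν ∂μ) ^ (1 / (2 : ℝ)) := by
        rw [← lintegral_prod (fun z => ‖u z.1 • B z‖ₑ ^ 2)
          ((hu.comp_fst.smul hB).enorm.pow_const 2), ← eLpNorm_two_sq, ← ENNReal.rpow_two,
          ← ENNReal.rpow_mul, mul_one_div_cancel two_ne_zero, ENNReal.rpow_one]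
    _ ≤ (∫⁻ x, ‖u x‖ₑ ^ (2 * p') ∂μ) ^ (1 / (2 * p')) *
        (∫⁻ x, ((∫⁻ y, ‖B (x, y)‖ₑ ^ 2 ∂ν) ^ (1 / 2 : ℝ)) ^ (2 * p) ∂μ) ^ (1 / (2 * p)) := by
        simp_rw [hsection]
        exact ENNReal.lintegral_Lp_mul_le_Lq_mul_Lr two_pos (by linarith [hp.symm.lt]) hexp μ
          hu.enorm ((hB.enorm.pow_const 2).lintegral_prod_right'.pow_const _)
    _ = _ := by
        rw [eLpNorm_eq_lintegral_rpow_enorm_toReal (by simpa using hp0') ENNReal.ofReal_ne_top,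
          ENNReal.toReal_ofReal hp0'.le]

theorem lintegral_enorm_mul_mul_le {α : Type*} [MeasurableSpace α] {μ : Measure α} {p p' : ℝ}
    (hp : p.HolderConjugate p') {q u v : α → ℂ} (hq : AEStronglyMeasurable q μ)
    (hu : AEStronglyMeasurable u μ) (hv : AEStronglyMeasurable v μ) :
    ∫⁻ x, ‖q x * u x * v x‖ₑ ∂μ ≤ eLpNorm q (ENNReal.ofReal p) μ *
      eLpNorm u (ENNReal.ofReal (2 * p')) μ * eLpNorm v (ENNReal.ofReal (2 * p')) μ := by
  have hp' : 0 < 2 * p' := mul_pos two_pos hp.symm.pos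
  have hconj := hp.ennrealOfReal
  have htriple : ENNReal.HolderTriple (ENNReal.ofReal (2 * p')) (ENNReal.ofReal (2 * p'))
      (ENNReal.ofReal p') :=
    Real.HolderTriple.ennrealOfReal ⟨by field_simp; norm_num, hp', hp'⟩
  simp_rw [← eLpNorm_one_eq_lintegral_enorm, mul_assoc]
  exact (eLpNorm_smul_le_mul_eLpNorm (q := ENNReal.ofReal p') (hu.mul hv) hq).trans
    (mul_le_mul_right (eLpNorm_smul_le_mul_eLpNorm hv hu) _)

/-- `B` multiplies `L^r(E)` into `L²(E × E)` when acting on functions of the first variable.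
Multiplication in the second variable is expressed through `B ∘ Prod.swap`. -/
structure IsMultiplier (r : ℝ≥0∞) (B : E × E → G) : Prop where
  aestronglyMeasurable : AEStronglyMeasurable B
  exists_eLpNorm_le : ∃ K : ℝ≥0, ∀ u : E → ℂ, AEStronglyMeasurable u →
    eLpNorm (fun z => u z.1 • B z) 2 ≤ K * eLpNorm u r

variable {r : ℝ≥0∞} {B B' : E × E → G} {u : E → ℂ}

theorem IsMultiplier.memLp (h : IsMultiplier r B) (hu : MemLp u r) :
    MemLp (fun z => u z.1 • B z) 2 := by
  obtain ⟨K, hK⟩ := h.exists_eLpNorm_le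
  exact ⟨hu.1.comp_fst.smul h.aestronglyMeasurable,
    (hK u hu.1).trans_lt (ENNReal.mul_lt_top ENNReal.coe_lt_top hu.2)⟩

theorem IsMultiplier.exists_eLpNorm_snd_le [SFinite (volume : Measure E)]
    (h : IsMultiplier r (B ∘ Prod.swap)) : ∃ K : ℝ≥0, ∀ u : E → ℂ, AEStronglyMeasurable u →
      eLpNorm (fun z => u z.2 • B z) 2 ≤ K * eLpNorm u r := by
  obtain ⟨K, hK⟩ := h.exists_eLpNorm_le
  have hswap : MeasurePreserving (Prod.swap : E × E → E × E) := Measure.measurePreserving_swap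
  refine ⟨K, fun u hu => ?_⟩
  have hmeas : AEStronglyMeasurable fun z : E × E => u z.1 • (B ∘ Prod.swap) z :=
    hu.comp_fst.smul h.aestronglyMeasurable
  exact (eLpNorm_comp_measurePreserving (p := 2) hmeas hswap).trans_le (hK u hu)

theorem IsMultiplier.memLp_snd [SFinite (volume : Measure E)] (h : IsMultiplier r (B ∘ Prod.swap))
    (hu : MemLp u r) : MemLp (fun z => u z.2 • B z) 2 :=
  (h.memLp hu).comp_measurePreserving Measure.measurePreserving_swap

theorem IsMultiplier.add (h : IsMultiplier r B) (h' : IsMultiplier r B') :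
    IsMultiplier r (B + B') := by
  obtain ⟨K, hK⟩ := h.exists_eLpNorm_le
  obtain ⟨K', hK'⟩ := h'.exists_eLpNorm_le
  refine ⟨h.1.add h'.1, K + K', fun u hu => ?_⟩
  simp_rw [Pi.add_apply, smul_add, ENNReal.coe_add, add_mul]
  exact (eLpNorm_add_le (hu.comp_fst.smul h.1) (hu.comp_fst.smul h'.1) one_le_two).trans
    (add_le_add (hK u hu) (hK' u hu))

theorem IsMultiplier.const_smul (h : IsMultiplier r B) (c : ℂ) : IsMultiplier r (c • B) := by
  obtain ⟨K, hK⟩ := h.exists_eLpNorm_le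
  refine ⟨h.1.const_smul c, ‖c‖₊ * K, fun u hu => ?_⟩
  simp_rw [Pi.smul_apply, smul_comm _ c, ENNReal.coe_mul, mul_assoc]
  exact (eLpNorm_const_smul c (fun z : E × E => u z.1 • B z) 2 volume).trans_le
    (mul_le_mul_right (hK u hu) _)

end Multipliers

section Potentials

variable {n : ℕ} {s : ℝ}

theorem antiPart_eq_add (A : RSpace n × RSpace n → CSpace n) :
    antiPart A = A + (-1 : ℂ) • symPart A := by
  rw [neg_one_smul, ← sub_eq_add_neg]
  rfl

theorem symPart_swap (A : RSpace n × RSpace n → CSpace n) : symPart A ∘ Prod.swap = symPart A := by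
  funext z
  rw [Function.comp_apply, symPart, symPart, Prod.swap_swap, add_comm]

theorem antiPart_swap (A : RSpace n × RSpace n → CSpace n) :
    antiPart A ∘ Prod.swap = -antiPart A := by
  funext z
  rw [Function.comp_apply, Pi.neg_apply, antiPart, ← Function.comp_apply (f := symPart A),
    symPart_swap, antiPart, symPart]
  module

/-- The pairs of potentials with `𝒥₁A, 𝒥₂A ∈ L^{2p}` and `q ∈ L^p`, for which the magnetic
Schrödinger form is finite on `Hˢ`. -/
structure IsPotential (p : ℝ) (A : RSpace n × RSpace n → CSpace n) (q : RSpace n → ℝ) : Prop where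
  aestronglyMeasurable : AEStronglyMeasurable A
  lintegral_J1_lt_top : ∫⁻ x, J1 A x ^ (2 * p) < ⊤
  lintegral_J2_lt_top : ∫⁻ x, J2 A x ^ (2 * p) < ⊤
  memLp : MemLp q (ENNReal.ofReal p)

theorem two_le_expo (n : ℕ) (s : ℝ) : 2 ≤ expo n s :=
  le_max_left _ _

theorem le_two_mul_mul_expo (n : ℕ) (hs : 0 < s) : (n : ℝ) ≤ 2 * s * expo n s := by
  rw [← div_le_iff₀' (by positivity)]
  exact le_max_right _ _

theorem MemP0.isPotential {Ω : Set (RSpace n)} {A : RSpace n × RSpace n → CSpace n}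
    {q : RSpace n → ℝ} (hΩ : MeasurableSet Ω) (h : MemP0 s Ω A q) : IsPotential (expo n s) A q where
  aestronglyMeasurable := h.meas
  lintegral_J1_lt_top := h.J1_mem
  lintegral_J2_lt_top := h.J2_mem
  memLp := by
    refine (memLp_congr_ae ?_).2 ((memLp_indicator_iff_restrict hΩ).2 h.q_mem)
    filter_upwards [(ae_restrict_iff' hΩ.compl).1 h.q_zero] with x hx
    by_cases hxΩ : x ∈ Ω
    · rw [Set.indicator_of_mem hxΩ]
    · rw [Set.indicator_of_notMem hxΩ, hx hxΩ]

variable {p p' : ℝ} {A : RSpace n × RSpace n → CSpace n} {q : RSpace n → ℝ}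

theorem isMultiplier_of_lintegral_J2_lt_top (hp : p.HolderConjugate p')
    (hA : AEStronglyMeasurable A) (hJ : ∫⁻ x, J2 A x ^ (2 * p) < ⊤) :
    IsMultiplier (ENNReal.ofReal (2 * p')) A := by
  have hK : (∫⁻ x, J2 A x ^ (2 * p)) ^ (1 / (2 * p)) ≠ ⊤ :=
    ENNReal.rpow_ne_top_of_nonneg (by have := hp.pos; positivity) hJ.ne
  refine ⟨hA, ((∫⁻ x, J2 A x ^ (2 * p)) ^ (1 / (2 * p))).toNNReal, fun u hu => ?_⟩
  rw [ENNReal.coe_toNNReal hK, mul_comm]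
  exact eLpNorm_fst_smul_le hp hu hA

theorem IsPotential.isMultiplier (hp : p.HolderConjugate p') (h : IsPotential p A q) :
    IsMultiplier (ENNReal.ofReal (2 * p')) A :=
  isMultiplier_of_lintegral_J2_lt_top hp h.aestronglyMeasurable h.lintegral_J2_lt_top

theorem IsPotential.isMultiplier_swap (hp : p.HolderConjugate p') (h : IsPotential p A q) :
    IsMultiplier (ENNReal.ofReal (2 * p')) (A ∘ Prod.swap) :=
  isMultiplier_of_lintegral_J2_lt_top hp
    (h.aestronglyMeasurable.comp_measurePreserving Measure.measurePreserving_swap)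
    h.lintegral_J1_lt_top

theorem IsPotential.isMultiplier_symPart (hp : p.HolderConjugate p') (h : IsPotential p A q) :
    IsMultiplier (ENNReal.ofReal (2 * p')) (symPart A) :=
  ((h.isMultiplier hp).add (h.isMultiplier_swap hp)).const_smul _

theorem IsPotential.isMultiplier_antiPart (hp : p.HolderConjugate p') (h : IsPotential p A q) :
    IsMultiplier (ENNReal.ofReal (2 * p')) (antiPart A) :=
  antiPart_eq_add A ▸ (h.isMultiplier hp).add ((h.isMultiplier_symPart hp).const_smul (-1))

theorem IsPotential.isMultiplier_symPart_swap (hp : p.HolderConjugate p') (h : IsPotential p A q) :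
    IsMultiplier (ENNReal.ofReal (2 * p')) (symPart A ∘ Prod.swap) :=
  symPart_swap A ▸ h.isMultiplier_symPart hp

theorem IsPotential.isMultiplier_antiPart_swap (hp : p.HolderConjugate p')
    (h : IsPotential p A q) : IsMultiplier (ENNReal.ofReal (2 * p')) (antiPart A ∘ Prod.swap) := by
  rw [antiPart_swap, ← neg_one_smul ℂ]
  exact (h.isMultiplier_antiPart hp).const_smul _

end Potentials

/-! ### The magnetic Schrödinger form -/

section Dot

variable {n : ℕ}

theorem norm_dot_le (a b : CSpace n) : ‖dot a b‖ ≤ ‖a‖ * ‖b‖ := by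
  rw [dot, EuclideanSpace.norm_eq, EuclideanSpace.norm_eq]
  refine (norm_sum_le _ _).trans ?_
  simp_rw [norm_mul]
  exact Real.sum_mul_le_sqrt_mul_sqrt _ _ _

theorem dot_comm (a b : CSpace n) : dot a b = dot b a := by
  simp [dot, mul_comm]

theorem dot_add_left (a b c : CSpace n) : dot (a + b) c = dot a c + dot b c := by
  simp [dot, add_mul, Finset.sum_add_distrib]

theorem dot_add_right (a b c : CSpace n) : dot a (b + c) = dot a b + dot a c := by
  rw [dot_comm, dot_add_left, dot_comm b, dot_comm c]

theorem dot_smul_left (c : ℂ) (a b : CSpace n) : dot (c • a) b = c * dot a b := by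
  simp [dot, Finset.mul_sum, mul_assoc]

theorem dot_smul_right (c : ℂ) (a b : CSpace n) : dot a (c • b) = c * dot a b := by
  rw [dot_comm, dot_smul_left, dot_comm]

theorem dot_neg_left (a b : CSpace n) : dot (-a) b = -dot a b := by
  rw [← neg_one_smul ℂ, dot_smul_left, neg_one_mul]

theorem dot_neg_right (a b : CSpace n) : dot a (-b) = -dot a b := by
  rw [dot_comm, dot_neg_left, dot_comm]

variable {α : Type*} [MeasurableSpace α] {μ : Measure α} {F G : α → CSpace n}

theorem aestronglyMeasurable_dot (hF : AEStronglyMeasurable F μ) (hG : AEStronglyMeasurable G μ) :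
    AEStronglyMeasurable (fun z => dot (F z) (G z)) μ :=
  Finset.aestronglyMeasurable_fun_sum _ fun i _ =>
    ((EuclideanSpace.proj (𝕜 := ℂ) i).continuous.comp_aestronglyMeasurable hF).mul
      ((EuclideanSpace.proj (𝕜 := ℂ) i).continuous.comp_aestronglyMeasurable hG)

theorem lintegral_enorm_dot_le (hF : AEStronglyMeasurable F μ) (hG : AEStronglyMeasurable G μ) :
    ∫⁻ z, ‖dot (F z) (G z)‖ₑ ∂μ ≤ eLpNorm F 2 μ * eLpNorm G 2 μ := by
  rw [← eLpNorm_one_eq_lintegral_enorm]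
  refine (eLpNorm_le_eLpNorm_mul_eLpNorm'_of_norm (q := 2) (p := 2) hF hG dot 1
    (.of_forall fun z => ?_)).trans_eq ?_
  · simpa using norm_dot_le (F z) (G z)
  · simp

theorem integrable_dot (hF : MemLp F 2 μ) (hG : MemLp G 2 μ) :
    Integrable (fun z => dot (F z) (G z)) μ :=
  ⟨aestronglyMeasurable_dot hF.1 hG.1, (lintegral_enorm_dot_le hF.1 hG.1).trans_lt
    (ENNReal.mul_lt_top hF.2 hG.2)⟩

theorem enorm_integral_dot_le (hF : AEStronglyMeasurable F μ) (hG : AEStronglyMeasurable G μ) :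
    ‖∫ z, dot (F z) (G z) ∂μ‖ₑ ≤ eLpNorm F 2 μ * eLpNorm G 2 μ :=
  (enorm_integral_le_lintegral_enorm _).trans (lintegral_enorm_dot_le hF hG)

theorem dot_toC_toC (a : RSpace n) : dot (toC a) (toC a) = ((‖a‖ ^ 2 : ℝ) : ℂ) := by
  rw [dot_self_of_real _ fun i => Complex.ofReal_im _, norm_toC]

theorem dot_parPart_alpha (s : ℝ) (B : RSpace n × RSpace n → CSpace n) (z : RSpace n × RSpace n) :
    dot (parPart B z) (alpha s z) = dot (B z) (alpha s z) := by
  rw [parPart]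
  split_ifs with hz
  · rfl
  have hnorm : ((‖z.1 - z.2‖ ^ 2 : ℝ) : ℂ) ≠ 0 :=
    Complex.ofReal_ne_zero.2 (pow_ne_zero 2 (norm_ne_zero_iff.2 (sub_ne_zero.2 hz)))
  rw [alpha_eq_smul, dot_smul_left, dot_smul_right, dot_smul_right, dot_toC_toC]
  field_simp

theorem dot_parPart_fracGrad (s : ℝ) (B : RSpace n × RSpace n → CSpace n) (u : RSpace n → ℂ)
    (z : RSpace n × RSpace n) :
    dot (parPart B z) (fracGrad s u z) = (u z.1 - u z.2) * dot (B z) (alpha s z) := by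
  rw [fracGrad, dot_smul_right, dot_parPart_alpha]

end Dot

section HsFinite

variable {E : Type*} [NormedAddCommGroup E] [InnerProductSpace ℝ E] [FiniteDimensional ℝ E]
  [MeasurableSpace E] [BorelSpace E]

/-- The measurable functions with finite `hsNorm s r`: all forms below are finite on them. -/
structure HsFinite (s r : ℝ) (u : E → ℂ) : Prop where
  aestronglyMeasurable : AEStronglyMeasurable u
  hsNorm_lt_top : hsNorm s r u < ⊤

theorem MemH.hsFinite [Nontrivial E] {s p p' : ℝ}
    (hs : s ∈ Set.Ioo (0 : ℝ) 1) (hp : p.HolderConjugate p')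
    (hsp : (Module.finrank ℝ E : ℝ) ≤ 2 * s * p) {u : E → ℂ} (hu : MemH s u) : HsFinite s p' u :=
  ⟨hu.choose.1, hu.hsNorm_lt_top hs hp hsp⟩

variable {n : ℕ} {s r : ℝ} {u v : RSpace n → ℂ} {B : RSpace n × RSpace n → CSpace n}

theorem HsFinite.memLp (hu : HsFinite s r u) : MemLp u (ENNReal.ofReal (2 * r)) :=
  ⟨hu.1, le_self_add.trans_lt hu.2⟩

theorem HsFinite.memLp_fracGrad (hs : 0 < s) (hu : HsFinite s r u) : MemLp (fracGrad s u) 2 :=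
  ⟨aestronglyMeasurable_fracGrad hu.1, (eLpNorm_fracGrad_le_hsNorm hs r u).trans_lt
    (ENNReal.mul_lt_top enorm_lt_top hu.2)⟩

theorem integrable_diff_mul_diff_mul_dot (hs : 0 < s)
    (hB : IsMultiplier (ENNReal.ofReal (2 * r)) B)
    (hB' : IsMultiplier (ENNReal.ofReal (2 * r)) (B ∘ Prod.swap)) (hu : HsFinite s r u)
    (hv : HsFinite s r v) :
    Integrable fun z => (u z.1 - u z.2) * (v z.1 - v z.2) * dot (B z) (alpha s z) := by
  have hdiff := integrable_dot ((hB.memLp hu.memLp).sub (hB'.memLp_snd hu.memLp))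
    (hv.memLp_fracGrad hs)
  simp_rw [Pi.sub_apply, ← sub_smul, fracGrad, dot_smul_left, dot_smul_right, ← mul_assoc] at hdiff
  exact hdiff

theorem mul_sub_mul_mul_dot (s : ℝ) (u v : RSpace n → ℂ) (B : RSpace n × RSpace n → CSpace n)
    (z : RSpace n × RSpace n) :
    (u z.1 * v z.1 - u z.2 * v z.2) * dot (B z) (alpha s z) =
      dot (u z.1 • B z) (fracGrad s v z) + dot (v z.2 • B z) (fracGrad s u z) := by
  simp only [fracGrad, dot_smul_left, dot_smul_right]
  ring

theorem integrable_mul_sub_mul_mul_dot (hs : 0 < s) (hB : IsMultiplier (ENNReal.ofReal (2 * r)) B)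
    (hB' : IsMultiplier (ENNReal.ofReal (2 * r)) (B ∘ Prod.swap)) (hu : HsFinite s r u)
    (hv : HsFinite s r v) :
    Integrable fun z => (u z.1 * v z.1 - u z.2 * v z.2) * dot (B z) (alpha s z) := by
  simp_rw [mul_sub_mul_mul_dot]
  exact (integrable_dot (hB.memLp hu.memLp) (hv.memLp_fracGrad hs)).add
    (integrable_dot (hB'.memLp_snd hv.memLp) (hu.memLp_fracGrad hs))

theorem exists_enorm_integral_mul_sub_mul_mul_dot_le (hs : 0 < s)
    (hB : IsMultiplier (ENNReal.ofReal (2 * r)) B)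
    (hB' : IsMultiplier (ENNReal.ofReal (2 * r)) (B ∘ Prod.swap)) :
    ∃ C : ℝ≥0, ∀ u v : RSpace n → ℂ, HsFinite s r u → HsFinite s r v →
      ‖∫ z, (u z.1 * v z.1 - u z.2 * v z.2) * dot (B z) (alpha s z)‖ₑ ≤
        C * hsNorm s r u * hsNorm s r v := by
  obtain ⟨K, hK⟩ := hB.exists_eLpNorm_le
  obtain ⟨K', hK'⟩ := hB'.exists_eLpNorm_snd_le
  set c := ‖√(fracConst n s) / √2‖₊
  refine ⟨(K + K') * c, fun u v hu hv => ?_⟩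
  have hgrad (w : RSpace n → ℂ) : eLpNorm (fracGrad s w) 2 ≤ c * hsNorm s r w :=
    eLpNorm_fracGrad_le_hsNorm hs r w
  have hfst := hB.memLp hu.memLp
  have hsnd := hB'.memLp_snd hv.memLp
  simp_rw [mul_sub_mul_mul_dot]
  rw [integral_add (integrable_dot hfst (hv.memLp_fracGrad hs))
    (integrable_dot hsnd (hu.memLp_fracGrad hs))]
  calc _ ≤ K * hsNorm s r u * (c * hsNorm s r v) + K' * hsNorm s r v * (c * hsNorm s r u) := by
        refine (enorm_add_le _ _).trans (add_le_add ?_ ?_)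
        · exact (enorm_integral_dot_le hfst.1 (hv.memLp_fracGrad hs).1).trans (mul_le_mul'
            ((hK u hu.1).trans (mul_le_mul_right le_self_add _)) (hgrad v))
        · exact (enorm_integral_dot_le hsnd.1 (hu.memLp_fracGrad hs).1).trans (mul_le_mul'
            ((hK' v hv.1).trans (mul_le_mul_right le_self_add _)) (hgrad u))
    _ = _ := by push_cast; ring

end HsFinite

section Form

variable {n : ℕ} {s p p' : ℝ} {A : RSpace n × RSpace n → CSpace n} {q : RSpace n → ℝ}
  {u v : RSpace n → ℂ}

theorem integral_eq_zero_of_swap_neg {α F : Type*} [MeasurableSpace α] {μ : Measure α} [SFinite μ]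
    [NormedAddCommGroup F] [NormedSpace ℝ F] {f : α × α → F} (hf : ∀ z, f z.swap = -f z) :
    ∫ z, f z ∂μ.prod μ = 0 := by
  have hswap := integral_prod_swap (μ := μ) (ν := μ) f
  simp_rw [hf, integral_neg] at hswap
  have := IsAddTorsionFree.of_isTorsionFree ℝ F
  exact self_eq_neg.1 hswap.symm

/-- The part of the magnetic form that involves the antisymmetric part of the potential. -/
def antiForm (s : ℝ) (A : RSpace n × RSpace n → CSpace n) (u v : RSpace n → ℂ) : ℂ :=
  ∫ z, (u z.1 - u z.2) * (v z.1 - v z.2) * dot (antiPart A z) (alpha s z)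

theorem IsPotential.integrable_diff_mul_diff_mul_dot_antiPart (hs : 0 < s)
    (hp : p.HolderConjugate p') (h : IsPotential p A q) (hu : HsFinite s p' u)
    (hv : HsFinite s p' v) :
    Integrable fun z => (u z.1 - u z.2) * (v z.1 - v z.2) * dot (antiPart A z) (alpha s z) :=
  integrable_diff_mul_diff_mul_dot hs (h.isMultiplier_antiPart hp)
    (h.isMultiplier_antiPart_swap hp) hu hv

/-- With `δw = w(x) - w(y)`, the left-hand integrand is `(δu δv + δ(uv)) A·α`. Since `α` is
antisymmetric, the two products `δu δv A_s·α` and `δ(uv) A_a·α` are odd and integrate to `0`. -/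
theorem integral_cross_eq (hs : 0 < s) (hp : p.HolderConjugate p') (h : IsPotential p A q)
    (hu : HsFinite s p' u) (hv : HsFinite s p' v) :
    ∫ z, (dot (u z.1 • A z) (fracGrad s v z) + dot (v z.1 • A z) (fracGrad s u z)) =
      antiForm s A u v +
        ∫ z, (u z.1 * v z.1 - u z.2 * v z.2) * dot (symPart A z) (alpha s z) := by
  have hcross :=
    (integrable_dot ((h.isMultiplier hp).memLp hu.memLp) (hv.memLp_fracGrad hs)).fun_add
      (integrable_dot ((h.isMultiplier hp).memLp hv.memLp) (hu.memLp_fracGrad hs))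
  have hanti := h.integrable_diff_mul_diff_mul_dot_antiPart hs hp hu hv
  have hsym := integrable_mul_sub_mul_mul_dot hs (h.isMultiplier_symPart hp)
    (h.isMultiplier_symPart_swap hp) hu hv
  rw [antiForm, ← integral_add hanti hsym, ← sub_eq_zero,
    ← integral_sub hcross (hanti.fun_add hsym), Measure.volume_eq_prod]
  have hodd (z : RSpace n × RSpace n) :
      dot (u z.1 • A z) (fracGrad s v z) + dot (v z.1 • A z) (fracGrad s u z) -
        ((u z.1 - u z.2) * (v z.1 - v z.2) * dot (antiPart A z) (alpha s z) +
          (u z.1 * v z.1 - u z.2 * v z.2) * dot (symPart A z) (alpha s z)) =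
      (u z.1 - u z.2) * (v z.1 - v z.2) * dot (symPart A z) (alpha s z) +
        (u z.1 * v z.1 - u z.2 * v z.2) * dot (antiPart A z) (alpha s z) := by
    have hA : dot (A z) (alpha s z) =
        dot (symPart A z) (alpha s z) + dot (antiPart A z) (alpha s z) := by
      rw [← dot_add_left, antiPart, add_sub_cancel]
    simp only [fracGrad, dot_smul_left, dot_smul_right, hA]
    ring
  simp_rw [hodd]
  refine integral_eq_zero_of_swap_neg fun z => ?_
  have hsymPart : symPart A z.swap = symPart A z := congrFun (symPart_swap A) z
  have hantiPart : antiPart A z.swap = -antiPart A z := congrFun (antiPart_swap A) z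
  rw [hsymPart, hantiPart, alpha_swap, dot_neg_right, dot_neg_right, dot_neg_left,
    Prod.fst_swap, Prod.snd_swap]
  ring

theorem magLaplacian_eq (hs : 0 < s) (hp : p.HolderConjugate p') (h : IsPotential p A q)
    (hu : HsFinite s p' u) (hv : HsFinite s p' v) :
    magLaplacian s A u v = (∫ z, dot (fracGrad s u z) (fracGrad s v z)) + antiForm s A u v +
      (∫ z, (u z.1 * v z.1 - u z.2 * v z.2) * dot (symPart A z) (alpha s z)) +
      ∫ z, dot (u z.1 • A z) (v z.1 • A z) := by
  have hAu := (h.isMultiplier hp).memLp hu.memLp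
  have hAv := (h.isMultiplier hp).memLp hv.memLp
  have hgu := hu.memLp_fracGrad hs
  have hgv := hv.memLp_fracGrad hs
  have hcross := (integrable_dot hAu hgv).fun_add (integrable_dot hAv hgu)
  rw [add_assoc (integral _ _), ← integral_cross_eq hs hp h hu hv,
    ← integral_add (integrable_dot hgu hgv) hcross,
    ← integral_add ((integrable_dot hgu hgv).fun_add hcross) (integrable_dot hAu hAv), magLaplacian]
  congr with z
  rw [magGrad, magGrad, dot_add_left, dot_add_right, dot_add_right,
    dot_comm (fracGrad s u z) (v z.1 • A z)]
  ring

theorem integral_dot_fst_smul (hp : p.HolderConjugate p') (h : IsPotential p A q)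
    (hu : HsFinite s p' u) (hv : HsFinite s p' v) :
    Integrable (fun x => (∫ y, dot (A (x, y)) (A (x, y))) * (u x * v x)) ∧
      ∫ x, (∫ y, dot (A (x, y)) (A (x, y))) * (u x * v x) =
        ∫ z, dot (u z.1 • A z) (v z.1 • A z) := by
  have hint := integrable_dot ((h.isMultiplier hp).memLp hu.memLp)
    ((h.isMultiplier hp).memLp hv.memLp)
  have hsection (x : RSpace n) : ∫ y, dot (u x • A (x, y)) (v x • A (x, y)) =
      (∫ y, dot (A (x, y)) (A (x, y))) * (u x * v x) := by
    simp_rw [dot_smul_left, dot_smul_right, ← mul_assoc, integral_const_mul]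
    ring
  simp_rw [← hsection]
  rw [Measure.volume_eq_prod] at hint ⊢
  exact ⟨hint.integral_prod_left, (integral_prod _ hint).symm⟩

theorem IsPotential.integrable_mul (hp : p.HolderConjugate p') (h : IsPotential p A q)
    (hu : HsFinite s p' u) (hv : HsFinite s p' v) : Integrable fun x => (q x : ℂ) * u x * v x :=
  ⟨(h.memLp.ofReal.1.mul hu.1).mul hv.1,
    (lintegral_enorm_mul_mul_le hp h.memLp.ofReal.1 hu.1 hv.1).trans_lt
      (ENNReal.mul_lt_top (ENNReal.mul_lt_top h.memLp.ofReal.2 hu.memLp.2) hv.memLp.2)⟩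

theorem Q_mul (hp : p.HolderConjugate p') (h : IsPotential p A q)
    (hu : HsFinite s p' u) (hv : HsFinite s p' v) :
    Q s A q (fun x => u x * v x) = (∫ x, (q x : ℂ) * u x * v x) +
      (∫ z, dot (u z.1 • A z) (v z.1 • A z)) +
      ∫ z, (u z.1 * v z.1 - u z.2 * v z.2) * dot (symPart A z) (alpha s z) := by
  obtain ⟨hint, heq⟩ := integral_dot_fst_smul hp h hu hv
  simp_rw [Q, fracDiv, dot_parPart_fracGrad, ← heq]
  rw [← integral_add (h.integrable_mul hp hu hv) hint]
  simp_rw [add_mul, mul_assoc]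

theorem magSchrodinger_eq (hs : 0 < s) (hp : p.HolderConjugate p') (h : IsPotential p A q)
    (hu : HsFinite s p' u) (hv : HsFinite s p' v) :
    magSchrodinger s A q u v = (∫ z, dot (fracGrad s u z) (fracGrad s v z)) +
      antiForm s A u v + Q s A q (fun x => u x * v x) := by
  rw [magSchrodinger, magLaplacian_eq hs hp h hu hv, Q_mul hp h hu hv]
  ring

theorem exists_enorm_Q_mul_le (hs : 0 < s) (hp : p.HolderConjugate p') (h : IsPotential p A q) :
    ∃ C : ℝ≥0, ∀ u v : RSpace n → ℂ, HsFinite s p' u → HsFinite s p' v →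
      ‖Q s A q (fun x => u x * v x)‖ₑ ≤ C * hsNorm s p' u * hsNorm s p' v := by
  obtain ⟨K, hK⟩ := (h.isMultiplier hp).exists_eLpNorm_le
  obtain ⟨C, hC⟩ := exists_enorm_integral_mul_sub_mul_mul_dot_le hs (h.isMultiplier_symPart hp)
    (h.isMultiplier_symPart_swap hp)
  have hq : MemLp (fun x => (q x : ℂ)) (ENNReal.ofReal p) := h.memLp.ofReal
  set Kq := (eLpNorm (fun x => (q x : ℂ)) (ENNReal.ofReal p)).toNNReal
  have hKq' : eLpNorm (fun x => (q x : ℂ)) (ENNReal.ofReal p) = Kq :=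
    (ENNReal.coe_toNNReal hq.2.ne).symm
  refine ⟨Kq + K * K + C, fun u v hu hv => ?_⟩
  have hL (w : RSpace n → ℂ) : eLpNorm w (ENNReal.ofReal (2 * p')) ≤ hsNorm s p' w := le_self_add
  have hA {w : RSpace n → ℂ} (hw : HsFinite s p' w) :
      eLpNorm (fun z : RSpace n × RSpace n => w z.1 • A z) 2 ≤ K * hsNorm s p' w :=
    (hK w hw.1).trans (mul_le_mul_right (hL w) _)
  rw [Q_mul hp h hu hv]
  calc _ ≤ Kq * hsNorm s p' u * hsNorm s p' v + K * hsNorm s p' u * (K * hsNorm s p' v) +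
        C * hsNorm s p' u * hsNorm s p' v := by
        refine (enorm_add_le _ _).trans (add_le_add ((enorm_add_le _ _).trans (add_le_add ?_ ?_))
          (hC u v hu hv))
        · refine (enorm_integral_le_lintegral_enorm _).trans
            ((lintegral_enorm_mul_mul_le hp hq.1 hu.1 hv.1).trans ?_)
          rw [hKq']
          exact mul_le_mul' (mul_le_mul_right (hL u) _) (hL v)
        · exact (enorm_integral_dot_le ((h.isMultiplier hp).memLp hu.memLp).1
            ((h.isMultiplier hp).memLp hv.memLp).1).trans (mul_le_mul' (hA hu) (hA hv))
    _ = _ := by push_cast; ring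

theorem Q_add_mul (hs : 0 < s) (hp : p.HolderConjugate p') (h : IsPotential p A q)
    {u' : RSpace n → ℂ} (hu : HsFinite s p' u) (hu' : HsFinite s p' u') (hv : HsFinite s p' v) :
    Q s A q (fun x => (u + u') x * v x) =
      Q s A q (fun x => u x * v x) + Q s A q (fun x => u' x * v x) := by
  have hpot {w : RSpace n → ℂ} (hw : HsFinite s p' w) :
      Integrable fun x => ((q x : ℂ) + ∫ y, dot (A (x, y)) (A (x, y))) * (w x * v x) := by
    simp_rw [add_mul, ← mul_assoc (q _ : ℂ)]
    exact (h.integrable_mul hp hw hv).add (integral_dot_fst_smul hp h hw hv).1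
  have hdiv {w : RSpace n → ℂ} (hw : HsFinite s p' w) :=
    integrable_mul_sub_mul_mul_dot hs (h.isMultiplier_symPart hp) (h.isMultiplier_symPart_swap hp)
      hw hv
  simp_rw [Q, fracDiv, dot_parPart_fracGrad]
  rw [add_add_add_comm, ← integral_add (hpot hu) (hpot hu'), ← integral_add (hdiv hu) (hdiv hu')]
  congr with x <;> simp only [Pi.add_apply] <;> ring

end Form

section Density

variable {n : ℕ} {s p p' : ℝ} {A A' : RSpace n × RSpace n → CSpace n} {q q' : RSpace n → ℝ}
  {u v : RSpace n → ℂ}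

theorem Q_mul_eq_of_forall_contDiff_left [Nontrivial (RSpace n)] (hs : s ∈ Set.Ioo (0 : ℝ) 1)
    (hp : p.HolderConjugate p') (hsp : (n : ℝ) ≤ 2 * s * p) (h : IsPotential p A q)
    (h' : IsPotential p A' q') (hv : HsFinite s p' v)
    (hφ : ∀ φ : RSpace n → ℂ, ContDiff ℝ ∞ φ → HasCompactSupport φ →
      Q s A q (fun x => φ x * v x) = Q s A' q' (fun x => φ x * v x)) (hu : MemH s u) :
    Q s A q (fun x => u x * v x) = Q s A' q' (fun x => u x * v x) := by
  rw [← finrank_euclideanSpace_fin (𝕜 := ℝ) (n := n)] at hsp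
  obtain ⟨C, hC⟩ := exists_enorm_Q_mul_le hs.1 hp h
  obtain ⟨C', hC'⟩ := exists_enorm_Q_mul_le hs.1 hp h'
  by_contra hne
  have hfin : (C + C') * hsNorm s p' v ≠ ⊤ := by have := hv.hsNorm_lt_top; finiteness
  obtain ⟨ε, hε, hlt⟩ := ENNReal.exists_nnreal_pos_mul_lt hfin
    (enorm_ne_zero.2 (sub_ne_zero.2 hne))
  obtain ⟨φ, hφ₁, hφ₂, hle⟩ := hu.exists_contDiff_hsNorm_sub_le hs hp hsp
    (ENNReal.coe_ne_zero.2 hε.ne')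
  have hφfin : HsFinite s p' φ := (memH_of_contDiff hφ₁ hφ₂).hsFinite hs hp hsp
  have hdiff : HsFinite s p' (u - φ) :=
    ⟨(hu.hsFinite hs hp hsp).1.sub hφfin.1, hle.trans_lt ENNReal.coe_lt_top⟩
  have hsplit := Q_add_mul hs.1 hp h hdiff hφfin hv
  have hsplit' := Q_add_mul hs.1 hp h' hdiff hφfin hv
  rw [sub_add_cancel] at hsplit hsplit'
  rw [hsplit, hsplit', hφ φ hφ₁ hφ₂, add_sub_add_right_eq_sub] at hlt
  refine hlt.not_ge ?_
  calc _ ≤ C * hsNorm s p' (u - φ) * hsNorm s p' v + C' * hsNorm s p' (u - φ) * hsNorm s p' v :=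
        enorm_sub_le.trans (add_le_add (hC _ _ hdiff hv) (hC' _ _ hdiff hv))
    _ ≤ C * ε * hsNorm s p' v + C' * ε * hsNorm s p' v := by gcongr
    _ = _ := by ring

theorem Q_mul_eq_of_forall_contDiff [Nontrivial (RSpace n)] (hs : s ∈ Set.Ioo (0 : ℝ) 1)
    (hp : p.HolderConjugate p') (hsp : (n : ℝ) ≤ 2 * s * p) (h : IsPotential p A q)
    (h' : IsPotential p A' q')
    (hQ : ∀ φ : RSpace n → ℂ, ContDiff ℝ ∞ φ → HasCompactSupport φ → Q s A q φ = Q s A' q' φ)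
    (hu : MemH s u) (hv : MemH s v) :
    Q s A q (fun x => u x * v x) = Q s A' q' (fun x => u x * v x) := by
  have hfin {w : RSpace n → ℂ} (hw : MemH s w) : HsFinite s p' w :=
    hw.hsFinite hs hp (by rwa [finrank_euclideanSpace_fin])
  refine Q_mul_eq_of_forall_contDiff_left hs hp hsp h h' (hfin hv) (fun φ hφ₁ hφ₂ => ?_) hu
  simp_rw [mul_comm (φ _)]
  exact Q_mul_eq_of_forall_contDiff_left hs hp hsp h h' (hfin (memH_of_contDiff hφ₁ hφ₂))
    (fun ψ hψ₁ hψ₂ => hQ _ (hψ₁.mul hφ₁) hψ₂.mul_right) hv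

end Density

/-! ### Kernels tested against products of differences -/

section Rectangle

variable {X Y F : Type*} [MeasurableSpace X] [MeasurableSpace Y] [NormedAddCommGroup F]
  [NormedSpace ℝ F] [CompleteSpace F]

theorem ae_eq_zero_of_forall_setIntegral_prod_eq_zero {μ : Measure (X × Y)} {K : X × Y → F}
    (hK : Integrable K μ)
    (h : ∀ S T, MeasurableSet S → MeasurableSet T → ∫ z in S ×ˢ T, K z ∂μ = 0) :
    K =ᵐ[μ] 0 := by
  refine hK.ae_eq_zero_of_forall_setIntegral_eq_zero fun t ht _ => ?_
  have huniv : ∫ z, K z ∂μ = 0 := by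
    simpa using h Set.univ Set.univ .univ .univ
  refine MeasurableSpace.induction_on_inter (C := fun t _ => ∫ z in t, K z ∂μ = 0)
    generateFrom_prod.symm isPiSystem_prod (by simp) ?_ ?_ ?_ t ht
  · rintro _ ⟨S, hS, T, hT, rfl⟩
    exact h S T hS hT
  · intro t ht h0
    rwa [← integral_add_compl ht hK, h0, zero_add] at huniv
  · intro f hdisj hmeas h0
    rw [integral_iUnion hmeas hdisj hK.integrableOn]
    simp [h0]

theorem integral_diff_mul_diff_smul_eq {X F : Type*} [MeasurableSpace X] [NormedAddCommGroup F]
    [NormedSpace ℝ F] {μ : Measure X} [SFinite μ] {K : X × X → F} (hK : ∀ z, K z.swap = K z)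
    {φ ψ : X → ℝ} (hφψ : ∀ x, φ x * ψ x = 0)
    (hint : Integrable (fun z => (φ z.1 * ψ z.2) • K z) (μ.prod μ)) :
    ∫ z, ((φ z.1 - φ z.2) * (ψ z.1 - ψ z.2)) • K z ∂μ.prod μ =
      (-2 : ℝ) • ∫ z, (φ z.1 * ψ z.2) • K z ∂μ.prod μ := by
  have hpt (z : X × X) : ((φ z.1 - φ z.2) * (ψ z.1 - ψ z.2)) • K z =
      -((φ z.1 * ψ z.2) • K z + (φ z.swap.1 * ψ z.swap.2) • K z.swap) := by
    rw [hK, Prod.fst_swap, Prod.snd_swap, ← add_smul, ← neg_smul]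
    congr 1
    linear_combination hφψ z.1 + hφψ z.2
  have hint_swap : Integrable (fun z => (φ z.swap.1 * ψ z.swap.2) • K z.swap) (μ.prod μ) :=
    hint.swap
  simp_rw [hpt]
  rw [integral_neg, integral_add hint hint_swap,
    integral_prod_swap (fun z => (φ z.1 * ψ z.2) • K z), neg_smul, two_smul]

end Rectangle

section Kernel

variable {E E' F : Type*} [NormedAddCommGroup E] [NormedSpace ℝ E] [FiniteDimensional ℝ E]
  [MeasurableSpace E] [BorelSpace E] [NormedAddCommGroup E'] [NormedSpace ℝ E']
  [FiniteDimensional ℝ E'] [MeasurableSpace E'] [BorelSpace E'] [NormedAddCommGroup F]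
  [NormedSpace ℝ F]

theorem ae_restrict_eq_zero_of_integral_contDiff_smul_eq_zero [CompleteSpace F] {μ : Measure E}
    {U : Set E} (hU : IsOpen U) {f : E → F} (hf : IntegrableOn f U μ)
    (h : ∀ φ : E → ℝ, ContDiff ℝ ∞ φ → HasCompactSupport φ → tsupport φ ⊆ U →
      ∫ x in U, φ x • f x ∂μ = 0) :
    f =ᵐ[μ.restrict U] 0 := by
  filter_upwards [hU.ae_eq_zero_of_integral_contDiff_smul_eq_zero
    ((Integrable.locallyIntegrable hf).locallyIntegrableOn U) h, ae_restrict_mem hU.measurableSet]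
    with x hx hxU using hx hxU

theorem ae_eq_zero_of_ae_integral_contDiff_smul_eq_zero [CompleteSpace F] {X : Type*}
    [MeasurableSpace X] {μ : Measure X} [SFinite μ] {ν : Measure E} [SFinite ν] {V : Set E}
    (hV : IsOpen V) {K : X × E → F} (hK : Integrable K (μ.prod (ν.restrict V)))
    (h : ∀ ψ : E → ℝ, ContDiff ℝ ∞ ψ → HasCompactSupport ψ → tsupport ψ ⊆ V →
      ∀ᵐ x ∂μ, ∫ y in V, ψ y • K (x, y) ∂ν = 0) :
    K =ᵐ[μ.prod (ν.restrict V)] 0 := by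
  refine ae_eq_zero_of_forall_setIntegral_prod_eq_zero hK fun S T _ _ => ?_
  have hKS : Integrable K ((μ.restrict S).prod (ν.restrict V)) :=
    hK.mono_measure (Measure.prod_mono Measure.restrict_le_self le_rfl)
  have hsection : (fun y => ∫ x in S, K (x, y) ∂μ) =ᵐ[ν.restrict V] 0 := by
    refine ae_restrict_eq_zero_of_integral_contDiff_smul_eq_zero hV hKS.integral_prod_right
      fun ψ hψ hψc hψV => ?_
    obtain ⟨C, hC⟩ := hψc.exists_bound_of_continuous hψ.continuous
    have hψK : Integrable (fun z : X × E => ψ z.2 • K z) ((μ.restrict S).prod (ν.restrict V)) :=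
      hKS.bdd_smul C (by have := hψ.continuous; fun_prop) (.of_forall fun z => hC z.2)
    simp_rw [← integral_smul]
    rw [← integral_integral_swap hψK]
    exact integral_eq_zero_of_ae (ae_restrict_of_ae (h ψ hψ hψc hψV))
  rw [← Measure.prod_restrict, integral_prod_symm]
  · exact integral_eq_zero_of_ae (ae_restrict_of_ae hsection)
  · rw [Measure.prod_restrict]
    exact hK.restrict

theorem ae_restrict_prod_eq_zero_of_integral_contDiff_smul_eq_zero [CompleteSpace F]
    {μ : Measure E} {ν : Measure E'} [SFinite μ] [SFinite ν] {U : Set E} {V : Set E'}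
    (hU : IsOpen U) (hV : IsOpen V) {K : E × E' → F} (hK : IntegrableOn K (U ×ˢ V) (μ.prod ν))
    (h : ∀ φ : E → ℝ, ContDiff ℝ ∞ φ → HasCompactSupport φ → tsupport φ ⊆ U →
      ∀ ψ : E' → ℝ, ContDiff ℝ ∞ ψ → HasCompactSupport ψ → tsupport ψ ⊆ V →
        ∫ z in U ×ˢ V, (φ z.1 * ψ z.2) • K z ∂μ.prod ν = 0) :
    K =ᵐ[(μ.prod ν).restrict (U ×ˢ V)] 0 := by
  simp only [IntegrableOn, ← Measure.prod_restrict] at hK h ⊢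
  refine ae_eq_zero_of_ae_integral_contDiff_smul_eq_zero hV hK fun ψ hψ hψc hψV => ?_
  obtain ⟨D, hD⟩ := hψc.exists_bound_of_continuous hψ.continuous
  have hψK : Integrable (fun z : E × E' => ψ z.2 • K z) ((μ.restrict U).prod (ν.restrict V)) :=
    hK.bdd_smul D (by have := hψ.continuous; fun_prop) (.of_forall fun z => hD z.2)
  refine ae_restrict_eq_zero_of_integral_contDiff_smul_eq_zero hU hψK.integral_prod_left
    fun φ hφ hφc hφU => ?_
  obtain ⟨C, hC⟩ := hφc.exists_bound_of_continuous hφ.continuous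
  have hφψK : Integrable (fun z : E × E' => φ z.1 • ψ z.2 • K z)
      ((μ.restrict U).prod (ν.restrict V)) :=
    hψK.bdd_smul C (by have := hφ.continuous; fun_prop) (.of_forall fun z => hC z.1)
  have hφψ := h φ hφ hφc hφU ψ hψ hψc hψV
  simp_rw [mul_smul] at hφψ
  simpa only [integral_prod _ hφψK, integral_smul] using hφψ

theorem integrableOn_ball_prod_ball_of_diff_mul_diff {μ : Measure (E × E)} {K : E × E → F}
    (hK : ∀ φ ψ : E → ℝ, ContDiff ℝ ∞ φ → HasCompactSupport φ → ContDiff ℝ ∞ ψ →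
      HasCompactSupport ψ → Integrable (fun z => ((φ z.1 - φ z.2) * (ψ z.1 - ψ z.2)) • K z) μ)
    {x y : E} {r : ℝ} (hr : 0 < r) (hxy : 3 * r ≤ dist x y) :
    IntegrableOn K (Metric.ball x r ×ˢ Metric.ball y r) μ := by
  -- `χ x' - χ y' = 1` on the product of the balls
  let χ : ContDiffBump x := ⟨r, 2 * r, hr, by linarith⟩
  refine (hK χ χ χ.contDiff χ.hasCompactSupport χ.contDiff χ.hasCompactSupport).integrableOn
    |>.congr_fun (fun z hz => ?_) (measurableSet_ball.prod measurableSet_ball)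
  have hfar : 2 * r ≤ dist z.2 x := by
    linarith [dist_triangle_left x y z.2, Metric.mem_ball.1 hz.2]
  simp [χ.one_of_mem_closedBall (Metric.ball_subset_closedBall hz.1), χ.zero_of_le_dist hfar]

theorem ae_restrict_prod_eq_zero_of_integral_diff_mul_diff_eq_zero [CompleteSpace F]
    {μ : Measure E} [SFinite μ] {K : E × E → F} (hsymm : ∀ z, K z.swap = K z)
    (h : ∀ φ ψ : E → ℝ, ContDiff ℝ ∞ φ → HasCompactSupport φ → ContDiff ℝ ∞ ψ →
      HasCompactSupport ψ → (∀ x, φ x * ψ x = 0) →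
      ∫ z, ((φ z.1 - φ z.2) * (ψ z.1 - ψ z.2)) • K z ∂μ.prod μ = 0)
    {U V : Set E} (hU : IsOpen U) (hV : IsOpen V) (hUV : Disjoint U V)
    (hK : IntegrableOn K (U ×ˢ V) (μ.prod μ)) :
    K =ᵐ[(μ.prod μ).restrict (U ×ˢ V)] 0 := by
  refine ae_restrict_prod_eq_zero_of_integral_contDiff_smul_eq_zero hU hV hK
    fun φ hφ hφc hφU ψ hψ hψc hψV => ?_
  have hφ0 {x : E} (hx : x ∉ U) : φ x = 0 := image_eq_zero_of_notMem_tsupport (mt (@hφU x) hx)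
  have hψ0 {x : E} (hx : x ∉ V) : ψ x = 0 := image_eq_zero_of_notMem_tsupport (mt (@hψV x) hx)
  have hφψ (x : E) : φ x * ψ x = 0 := by
    by_cases hx : x ∈ U
    · rw [hψ0 (hUV.notMem_of_mem_left hx), mul_zero]
    · rw [hφ0 hx, zero_mul]
  have hsupp {z : E × E} (hz : z ∉ U ×ˢ V) : (φ z.1 * ψ z.2) • K z = 0 := by
    rcases not_and_or.1 hz with hz | hz
    · rw [hφ0 hz, zero_mul, zero_smul]
    · rw [hψ0 hz, mul_zero, zero_smul]
  have hint : Integrable (fun z => (φ z.1 * ψ z.2) • K z) (μ.prod μ) := by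
    obtain ⟨C, hC⟩ := hφc.exists_bound_of_continuous hφ.continuous
    obtain ⟨D, hD⟩ := hψc.exists_bound_of_continuous hψ.continuous
    rw [← integrableOn_iff_integrable_of_support_subset
      (Function.support_subset_iff'.2 fun z => hsupp)]
    refine hK.bdd_smul (C * D) ?_ (.of_forall fun z => ?_)
    · have := hφ.continuous
      have := hψ.continuous
      fun_prop
    · exact norm_mul_le_of_le (hC z.1) (hD z.2)
  rw [setIntegral_eq_integral_of_forall_compl_eq_zero fun z => hsupp]
  have h0 := h φ ψ hφ hφc hψ hψc hφψ
  rw [integral_diff_mul_diff_smul_eq hsymm hφψ hint] at h0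
  exact (smul_eq_zero.1 h0).resolve_left (by norm_num)

theorem ae_eq_zero_of_integral_diff_mul_diff_eq_zero [CompleteSpace F] {μ : Measure E} [SFinite μ]
    {K : E × E → F} (hsymm : ∀ z, K z.swap = K z)
    (hint : ∀ φ ψ : E → ℝ, ContDiff ℝ ∞ φ → HasCompactSupport φ → ContDiff ℝ ∞ ψ →
      HasCompactSupport ψ →
      Integrable (fun z => ((φ z.1 - φ z.2) * (ψ z.1 - ψ z.2)) • K z) (μ.prod μ))
    (h : ∀ φ ψ : E → ℝ, ContDiff ℝ ∞ φ → HasCompactSupport φ → ContDiff ℝ ∞ ψ →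
      HasCompactSupport ψ → (∀ x, φ x * ψ x = 0) →
      ∫ z, ((φ z.1 - φ z.2) * (ψ z.1 - ψ z.2)) • K z ∂μ.prod μ = 0) :
    ∀ᵐ z ∂μ.prod μ, z.1 ≠ z.2 → K z = 0 := by
  rw [ae_iff]
  refine measure_null_of_locally_null _ fun z hz => ?_
  obtain ⟨hne, -⟩ := Classical.not_imp.1 hz
  have hpos : 0 < dist z.1 z.2 := dist_pos.2 hne
  set r := dist z.1 z.2 / 3 with hr
  have hW : IsOpen (Metric.ball z.1 r ×ˢ Metric.ball z.2 r) :=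
    Metric.isOpen_ball.prod Metric.isOpen_ball
  have hzW : z ∈ Metric.ball z.1 r ×ˢ Metric.ball z.2 r :=
    ⟨Metric.mem_ball_self (by positivity), Metric.mem_ball_self (by positivity)⟩
  have hae := ae_restrict_prod_eq_zero_of_integral_diff_mul_diff_eq_zero hsymm h
    Metric.isOpen_ball Metric.isOpen_ball (Metric.ball_disjoint_ball (by linarith))
    (integrableOn_ball_prod_ball_of_diff_mul_diff hint (by positivity) (by linarith))
  rw [EventuallyEq, ae_restrict_iff' hW.measurableSet, ae_iff] at hae
  refine ⟨_, ?_, hae⟩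
  filter_upwards [mem_nhdsWithin_of_mem_nhds (hW.mem_nhds hzW), self_mem_nhdsWithin]
    with w hwW hw hw0 using hw fun _ => hw0 hwW

theorem ae_prod_fst_ne_snd {X : Type*} [MeasurableSpace X] [MeasurableEq X]
    {μ : Measure X} [SFinite μ] [NullSingletonClass μ] : ∀ᵐ z ∂μ.prod μ, z.1 ≠ z.2 := by
  have hdiag : {z : X × X | ¬z.1 ≠ z.2} = Set.diagonal X := by
    ext z
    exact not_not
  have hsection (x : X) : Prod.mk x ⁻¹' Set.diagonal X = {x} := by
    ext y
    exact eq_comm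
  rw [ae_iff, hdiag, Measure.measure_prod_null measurableSet_diagonal]
  exact .of_forall fun x => (congr_arg μ (hsection x)).trans (measure_singleton x)

end Kernel

/-! ### The gauge relation -/

section Gauge

variable {n : ℕ} {s p p' : ℝ} {A A' B B' : RSpace n × RSpace n → CSpace n} {q q' : RSpace n → ℝ}
  {u v : RSpace n → ℂ}

theorem parPart_eq_of_dot_alpha_eq (hn : 1 ≤ n) (hs : s ∈ Set.Ioo (0 : ℝ) 1)
    {z : RSpace n × RSpace n} (hz : z.1 ≠ z.2)
    (h : dot (B z) (alpha s z) = dot (B' z) (alpha s z)) : parPart B z = parPart B' z := by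
  have hdist : 0 < ‖z.2 - z.1‖ := norm_sub_pos_iff.2 hz.symm
  have hconst := fracConst_pos hn hs
  have hfactor : 0 < √(fracConst n s) / √2 / ‖z.2 - z.1‖ ^ ((n : ℝ) / 2 + s + 1) := by
    positivity
  rw [alpha_eq_smul, dot_smul_right, dot_smul_right] at h
  rw [parPart, parPart, if_neg hz, if_neg hz,
    mul_left_cancel₀ (Complex.ofReal_ne_zero.2 (neg_ne_zero.2 hfactor.ne')) h]

theorem antiForm_congr (h : parPart (antiPart A) =ᵐ[volume] parPart (antiPart A')) :
    antiForm s A u v = antiForm s A' u v := by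
  refine integral_congr_ae (h.mono fun z hz => ?_)
  simp only
  rw [← dot_parPart_alpha, hz, dot_parPart_alpha]

theorem Q_zero (s : ℝ) (A : RSpace n × RSpace n → CSpace n) (q : RSpace n → ℝ) :
    Q s A q (fun _ => 0) = 0 := by
  simp [Q, fracDiv, fracGrad, dot]

theorem memH_ofReal {t : ℝ} {φ : RSpace n → ℝ} (hφ : ContDiff ℝ ∞ φ) (hφc : HasCompactSupport φ) :
    MemH t fun x => (φ x : ℂ) :=
  memH_of_contDiff (Complex.ofRealCLM.contDiff.comp hφ)
    (hφc.comp_left (g := fun r : ℝ => (r : ℂ)) Complex.ofReal_zero)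

theorem magSchrodinger_eq_of_memH [Nontrivial (RSpace n)] (hs : s ∈ Set.Ioo (0 : ℝ) 1)
    (hp : p.HolderConjugate p') (hsp : (n : ℝ) ≤ 2 * s * p) (h : IsPotential p A q)
    (hu : MemH s u) (hv : MemH s v) :
    magSchrodinger s A q u v = (∫ z, dot (fracGrad s u z) (fracGrad s v z)) +
      (antiForm s A u v + Q s A q (fun x => u x * v x)) := by
  have hdim : (Module.finrank ℝ (RSpace n) : ℝ) ≤ 2 * s * p := by rwa [finrank_euclideanSpace_fin]
  rw [magSchrodinger_eq hs.1 hp h (hu.hsFinite hs hp hdim) (hv.hsFinite hs hp hdim), add_assoc]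

theorem gaugeEquiv_iff_antiForm_add_Q_eq [Nontrivial (RSpace n)] (hs : s ∈ Set.Ioo (0 : ℝ) 1)
    (hp : p.HolderConjugate p') (hsp : (n : ℝ) ≤ 2 * s * p) (h : IsPotential p A q)
    (h' : IsPotential p A' q') :
    GaugeEquiv s A q A' q' ↔ ∀ u, MemH s u → ∀ v, MemH s v →
      antiForm s A u v + Q s A q (fun x => u x * v x) =
        antiForm s A' u v + Q s A' q' (fun x => u x * v x) := by
  refine forall₄_congr fun u hu v hv => ?_
  rw [magSchrodinger_eq_of_memH hs hp hsp h hu hv, magSchrodinger_eq_of_memH hs hp hsp h' hu hv,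
    add_right_inj]

theorem dot_antiPart_alpha_swap (z : RSpace n × RSpace n) :
    dot (antiPart A z.swap) (alpha s z.swap) = dot (antiPart A z) (alpha s z) := by
  have hA : antiPart A z.swap = -antiPart A z := congr_fun (antiPart_swap A) z
  rw [hA, alpha_swap, dot_neg_left, dot_neg_right, neg_neg]

theorem dot_antiPart_alpha_ae_eq_of_antiForm_eq [Nontrivial (RSpace n)]
    (hs : s ∈ Set.Ioo (0 : ℝ) 1) (hp : p.HolderConjugate p') (hsp : (n : ℝ) ≤ 2 * s * p)
    (h : IsPotential p A q) (h' : IsPotential p A' q')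
    (heq : ∀ u v, MemH s u → MemH s v → (∀ x, u x * v x = 0) →
      antiForm s A u v = antiForm s A' u v) :
    ∀ᵐ z : RSpace n × RSpace n, z.1 ≠ z.2 →
      dot (antiPart A z) (alpha s z) = dot (antiPart A' z) (alpha s z) := by
  have hfin {φ : RSpace n → ℝ} (hφ : ContDiff ℝ ∞ φ) (hφc : HasCompactSupport φ) :
      HsFinite s p' fun x => (φ x : ℂ) :=
    (memH_ofReal hφ hφc).hsFinite hs hp (by rwa [finrank_euclideanSpace_fin])
  have hint {A : RSpace n × RSpace n → CSpace n} {q : RSpace n → ℝ} (h : IsPotential p A q)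
      {φ ψ : RSpace n → ℝ} (hφ : ContDiff ℝ ∞ φ) (hφc : HasCompactSupport φ) (hψ : ContDiff ℝ ∞ ψ)
      (hψc : HasCompactSupport ψ) : Integrable fun z =>
        ((φ z.1 : ℂ) - φ z.2) * (ψ z.1 - ψ z.2) * dot (antiPart A z) (alpha s z) :=
    h.integrable_diff_mul_diff_mul_dot_antiPart (u := fun x => (φ x : ℂ))
      (v := fun x => (ψ x : ℂ)) hs.1 hp (hfin hφ hφc) (hfin hψ hψc)
  have hsmul (φ ψ : RSpace n → ℝ) (z : RSpace n × RSpace n) :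
      ((φ z.1 - φ z.2) * (ψ z.1 - ψ z.2)) •
          (dot (antiPart A z) (alpha s z) - dot (antiPart A' z) (alpha s z)) =
        ((φ z.1 : ℂ) - φ z.2) * (ψ z.1 - ψ z.2) * dot (antiPart A z) (alpha s z) -
          ((φ z.1 : ℂ) - φ z.2) * (ψ z.1 - ψ z.2) * dot (antiPart A' z) (alpha s z) := by
    rw [Complex.real_smul, ← mul_sub]
    push_cast
    rfl
  have hae := ae_eq_zero_of_integral_diff_mul_diff_eq_zero (μ := (volume : Measure (RSpace n)))
    (K := fun z => dot (antiPart A z) (alpha s z) - dot (antiPart A' z) (alpha s z)) (fun z => ?_)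
    (fun φ ψ hφ hφc hψ hψc => ?_) fun φ ψ hφ hφc hψ hψc hφψ => ?_
  · exact hae.mono fun z hz hne => sub_eq_zero.1 (hz hne)
  · simp only [dot_antiPart_alpha_swap]
  · simp_rw [hsmul, ← Measure.volume_eq_prod]
    exact Integrable.sub (hint h hφ hφc hψ hψc) (hint h' hφ hφc hψ hψc)
  · have hform := heq _ _ (memH_ofReal hφ hφc) (memH_ofReal hψ hψc) fun x => by
      rw [← Complex.ofReal_mul, hφψ, Complex.ofReal_zero]
    simp_rw [hsmul, ← Measure.volume_eq_prod]
    rw [integral_sub (hint h hφ hφc hψ hψc) (hint h' hφ hφc hψ hψc)]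
    exact sub_eq_zero.2 hform

theorem GaugeEquiv.parPart_antiPart_ae_eq [Nontrivial (RSpace n)] (hn : 1 ≤ n)
    (hs : s ∈ Set.Ioo (0 : ℝ) 1) (hp : p.HolderConjugate p') (hsp : (n : ℝ) ≤ 2 * s * p)
    (h : IsPotential p A q) (h' : IsPotential p A' q') (hg : GaugeEquiv s A q A' q') :
    parPart (antiPart A) =ᵐ[volume] parPart (antiPart A') := by
  have hdot := dot_antiPart_alpha_ae_eq_of_antiForm_eq hs hp hsp h h' fun u v hu hv huv => by
    have hform := (gaugeEquiv_iff_antiForm_add_Q_eq hs hp hsp h h').1 hg u hu v hv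
    simpa only [huv, Q_zero, add_zero] using hform
  filter_upwards [hdot, ae_prod_fst_ne_snd (μ := volume)] with z hz hne
  exact parPart_eq_of_dot_alpha_eq hn hs hne (hz hne)

theorem GaugeEquiv.Q_eq [Nontrivial (RSpace n)] (hn : 1 ≤ n) (hs : s ∈ Set.Ioo (0 : ℝ) 1)
    (hp : p.HolderConjugate p') (hsp : (n : ℝ) ≤ 2 * s * p) (h : IsPotential p A q)
    (h' : IsPotential p A' q') (hg : GaugeEquiv s A q A' q') {φ : RSpace n → ℂ}
    (hφ : ContDiff ℝ ∞ φ) (hφc : HasCompactSupport φ) : Q s A q φ = Q s A' q' φ := by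
  obtain ⟨R, hR, hsupp⟩ := hφc.isBounded.subset_closedBall_lt 0 0
  let χ : ContDiffBump (0 : RSpace n) := ⟨R, 2 * R, hR, by linarith⟩
  have hφχ : (fun x => φ x * ((χ x : ℝ) : ℂ)) = φ := by
    ext x
    by_cases hx : x ∈ tsupport φ
    · rw [χ.one_of_mem_closedBall (hsupp hx), Complex.ofReal_one, mul_one]
    · rw [image_eq_zero_of_notMem_tsupport hx, zero_mul]
  have hform := (gaugeEquiv_iff_antiForm_add_Q_eq hs hp hsp h h').1 hg _ (memH_of_contDiff hφ hφc) _
    (memH_ofReal χ.contDiff χ.hasCompactSupport)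
  rw [antiForm_congr (hg.parPart_antiPart_ae_eq hn hs hp hsp h h'), hφχ] at hform
  exact add_left_cancel hform

end Gauge

end FracMag

end

theorem mainTheorem3_general {n : ℕ} (hn : 1 ≤ n) {s p : ℝ} (hs : s ∈ Set.Ioo (0 : ℝ) 1)
    (hp : 1 < p) (hsp : (n : ℝ) ≤ 2 * s * p)
    {A A' : FracMag.RSpace n × FracMag.RSpace n → FracMag.CSpace n}
    {q q' : FracMag.RSpace n → ℝ}
    (h : FracMag.IsPotential p A q) (h' : FracMag.IsPotential p A' q') :
    FracMag.GaugeEquiv s A q A' q' ↔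
      (FracMag.parPart (FracMag.antiPart A) =ᵐ[volume] FracMag.parPart (FracMag.antiPart A')) ∧
        ∀ φ : FracMag.RSpace n → ℂ, ContDiff ℝ ∞ φ → HasCompactSupport φ →
          FracMag.Q s A q φ = FracMag.Q s A' q' φ := by
  have : Nonempty (Fin n) := ⟨⟨0, hn⟩⟩
  have hp' := Real.HolderConjugate.conjExponent hp
  constructor
  · exact fun hg => ⟨hg.parPart_antiPart_ae_eq hn hs hp' hsp h h',
      fun φ hφ hφc => hg.Q_eq hn hs hp' hsp h h' hφ hφc⟩
  · rintro ⟨hA, hQ⟩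
    refine (FracMag.gaugeEquiv_iff_antiForm_add_Q_eq hs hp' hsp h h').2 fun u hu v hv => ?_
    rw [FracMag.antiForm_congr hA, FracMag.Q_mul_eq_of_forall_contDiff hs hp' hsp h h' hQ hu hv]

theorem mainTheorem3 (n : ℕ) (hn : 1 ≤ n) (s : ℝ) (hs : s ∈ Set.Ioo (0 : ℝ) 1)
    (Ω : Set (FracMag.RSpace n)) (hΩ : IsOpen Ω)
    (A A' : FracMag.RSpace n × FracMag.RSpace n → FracMag.CSpace n)
    (q q' : FracMag.RSpace n → ℝ)
    (h : FracMag.MemP0 s Ω A q) (h' : FracMag.MemP0 s Ω A' q') :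
    FracMag.GaugeEquiv s A q A' q' ↔
      (FracMag.parPart (FracMag.antiPart A) =ᵐ[MeasureTheory.volume]
          FracMag.parPart (FracMag.antiPart A')) ∧
        ∀ φ : FracMag.RSpace n → ℂ, ContDiff ℝ ∞ φ → HasCompactSupport φ →
          FracMag.Q s A q φ = FracMag.Q s A' q' φ := by
  exact mainTheorem3_general hn hs (one_lt_two.trans_le (FracMag.two_le_expo n s))
    (FracMag.le_two_mul_mul_expo n hs.1) (h.isPotential hΩ.measurableSet)
    (h'.isPotential hΩ.measurableSet)
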